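/- Let $n\ge 2$ and $s\ge 1$, and for points $p_1,\dots,p_s\in\mathbb P^n=\mathbb P^n_{\mathbb C}$ let $\pi:X\to\mathbb P^n$ be the blow-up at $p_1,\dots,p_s$, with exceptional divisors $E_1,\dots,E_s$; $H$ denotes the pull-back of the hyperplane class, so that $\operatorname{Pic}(X)=\mathbb Z H\oplus\bigoplus_i\mathbb Z E_i$. On $\operatorname{Pic}(X)$ consider the symmetric bilinear form with $\langle H,H\rangle=n-1$, $\langle H,E_i\rangle=0$, $\langle E_i,E_j\rangle=-\delta_{ij}$. Let $W$ be the Weyl group, i.e. the group of automorphisms of $\operatorname{Pic}(X)$ generated by the permutations of $E_1,\dots,E_s$ (fixing $H$) and, for every $J\subseteq\{1,\dots,s\}$ with $|J|=n+1$, by the standard Cremona transformation $$dH-\sum_i m_iE_i\ \longmapsto\ (d-c)H-\sum_{i\in J}(m_i-c)E_i-\sum_{i\notin J}m_iE_i,\qquad c=\sum_{i\in J}m_i-(n-1)d .$$ For integers $d,m_1,\dots,m_s$ let $\mathcal L=\mathcal L_{n,d}(m_1,\dots,m_s)=|dH-\sum_i m_iE_i|$ be the linear system on $X$ consisting of the effective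 divisors $\pi^*V-\sum_i m_iE_i$, where $V$ runs over the hypersurfaces of degree $d$ in $\mathbb P^n$ with multiplicity at least $m_i$ at $p_i$ for all $i$. Let $D=dH-\sum_i m_iE_i$, and let $F$ be a class in the $W$-orbit of some $E_i$ with $\langle D,F\rangle\le 0$. Then for general points $p_1,\dots,p_s$ (that is, for all $(p_1,\dots,p_s)$ in a nonempty Zariski-open subset of $(\mathbb P^n)^s$, which may depend on $n$, $s$, $D$ and $F$) the following holds. The class $F$ contains exactly one effective divisor, again denoted $F$, and this divisor is prime. If moreover $\mathcal L\neq\emptyset$, then $F$ is contained in the base locus of $\mathcal L$ with multiplicity exactly $-\langle D,F\rangle$: every member of $\mathcal L$ contains $F$ with multiplicity at least $-\langle D,F\rangle$, and some member contains it with multiplicity exactly $-\langle D,F\rangle$. -/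

import Mathlib

open MvPolynomial

/-!
Divisors on the blow-up `X` of complex projective space `ℙⁿ` at `s` points `p 0, …, p (s-1)`
(`n ≥ 2`, the points distinct).
-/

namespace BlowUp

/-- Points of `ℙⁿ` over `ℂ`. -/
abbrev Pt (n : ℕ) : Type := Projectivization ℂ (Fin (n + 1) → ℂ)

/-- The homogeneous coordinate ring of `ℙⁿ`. -/
abbrev CoordRing (n : ℕ) : Type := MvPolynomial (Fin (n + 1)) ℂ

/-! ### General points -/

/-- `g` is homogeneous separately in each of the `s` groups of `n + 1` variables. -/
def IsMultihomogeneous {n s : ℕ} (g : MvPolynomial (Fin s × Fin (n + 1)) ℂ) : Prop :=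
  ∀ i : Fin s, ∃ e : ℕ,
    IsWeightedHomogeneous (fun ij : Fin s × Fin (n + 1) => if ij.1 = i then 1 else 0) g e

/-- The Zariski-open subsets of `(ℙⁿ)ˢ`: complements of common zero sets of multihomogeneous
polynomials. (Vanishing does not depend on the chosen representatives.) -/
def IsZariskiOpen {n s : ℕ} (U : Set (Fin s → Pt n)) : Prop :=
  ∃ S : Set (MvPolynomial (Fin s × Fin (n + 1)) ℂ), (∀ g ∈ S, IsMultihomogeneous g) ∧
    U = {p | ∃ g ∈ S, eval (fun ij : Fin s × Fin (n + 1) => (p ij.1).rep ij.2) g ≠ 0}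

/-- `Q` holds for `s` general points of `ℙⁿ`: it holds on a nonempty Zariski-open subset
of `(ℙⁿ)ˢ`. -/
def ForGeneralPoints (n s : ℕ) (Q : (Fin s → Pt n) → Prop) : Prop :=
  ∃ U : Set (Fin s → Pt n), IsZariskiOpen U ∧ U.Nonempty ∧ ∀ p ∈ U, Q p

/-! ### Divisors on the blow-up -/

/-- The multiplicity at the point `x` of the hypersurface `f = 0`, for a nonzero form `f`:
the order of the Taylor expansion of `f` at a vector representing `x`. -/
noncomputable def multAt {n : ℕ} (x : Pt n) (f : CoordRing n) : ℕ :=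
  sInf {k : ℕ | homogeneousComponent k (aeval (fun j => X j + C (x.rep j)) f : CoordRing n) ≠ 0}

/-- Irreducible hypersurfaces of `ℙⁿ`, given by their homogeneous ideals. -/
def IrredHypersurface (n : ℕ) : Type :=
  {I : Ideal (CoordRing n) //
    ∃ (G : CoordRing n) (e : ℕ), Irreducible G ∧ G.IsHomogeneous e ∧ I = Ideal.span {G}}

/-- The prime divisors of the blow-up `X` of `ℙⁿ` at the points `p i`: the strict transforms of
the irreducible hypersurfaces of `ℙⁿ`, and the exceptional divisors. -/
inductive PrimeDivisor {n s : ℕ} (p : Fin s → Pt n) : Type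
  | strictTransform (Z : IrredHypersurface n) : PrimeDivisor p
  | exceptional (i : Fin s) : PrimeDivisor p

/-- Divisors on `X`. -/
abbrev Divisor {n s : ℕ} (p : Fin s → Pt n) : Type := PrimeDivisor p →₀ ℤ

/-- The order of vanishing, along a prime divisor of `X`, of the pull-back to `X` of a nonzero
form `f`. Along a strict transform it is the exponent of the irreducible equation in `f`;
along the exceptional divisor over `p i` it is the multiplicity of `f` at `p i`. -/
noncomputable def pullbackOrd {n s : ℕ} (p : Fin s → Pt n) (f : CoordRing n) :
    PrimeDivisor p → ℕ
  | .strictTransform Z => sSup {k : ℕ | f ∈ Z.1 ^ k}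
  | .exceptional i => multAt (p i) f

/-! ### The Picard group, the bilinear form and the Weyl group -/

/-- The Picard group of `X`: the pair `(d, m)` stands for the class `d H - ∑ i, m i • E i`. -/
abbrev Pic (s : ℕ) : Type := ℤ × (Fin s → ℤ)

/-- The class of the exceptional divisor `E i`. -/
def excClass {s : ℕ} (i : Fin s) : Pic s := (0, -Pi.single i 1)

/-- The symmetric bilinear form with `⟨H, H⟩ = n - 1`, `⟨H, E i⟩ = 0`, `⟨E i, E j⟩ = -δ i j`. -/
def form (n : ℕ) {s : ℕ} (A B : Pic s) : ℤ :=
  ((n : ℤ) - 1) * (A.1 * B.1) - ∑ i, A.2 i * B.2 i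

/-- The action on classes of the standard Cremona transformation based at the points indexed
by `J` (used for `J` of cardinality `n + 1`). -/
def cremonaFun (n : ℕ) {s : ℕ} (J : Finset (Fin s)) (A : Pic s) : Pic s :=
  (A.1 - (∑ j ∈ J, A.2 j - ((n : ℤ) - 1) * A.1),
    fun i => if i ∈ J then A.2 i - (∑ j ∈ J, A.2 j - ((n : ℤ) - 1) * A.1) else A.2 i)

theorem cremonaFun_involutive (n : ℕ) {s : ℕ} (J : Finset (Fin s)) (hJ : J.card = n + 1) :
    Function.Involutive (cremonaFun n J) := by
  rintro ⟨d, m⟩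
  have h : ∑ j ∈ J, (cremonaFun n J (d, m)).2 j
      = ∑ j ∈ J, m j - ((n : ℤ) + 1) * (∑ j ∈ J, m j - ((n : ℤ) - 1) * d) := by
    have : ∑ j ∈ J, (cremonaFun n J (d, m)).2 j
        = ∑ j ∈ J, (m j - (∑ j ∈ J, m j - ((n : ℤ) - 1) * d)) :=
      Finset.sum_congr rfl fun j hj => by simp [cremonaFun, hj]
    rw [this, Finset.sum_sub_distrib, Finset.sum_const, hJ]
    simp
  have hc : ∑ j ∈ J, (cremonaFun n J (d, m)).2 j - ((n : ℤ) - 1) * (cremonaFun n J (d, m)).1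
      = -(∑ j ∈ J, m j - ((n : ℤ) - 1) * d) := by
    rw [h]; simp only [cremonaFun]; ring
  refine Prod.ext ?_ (funext fun i => ?_)
  · change (cremonaFun n J (d, m)).1 - _ = d
    rw [hc]; simp only [cremonaFun]; ring
  · change (if i ∈ J then (cremonaFun n J (d, m)).2 i - _ else (cremonaFun n J (d, m)).2 i) = m i
    rw [hc]
    by_cases hi : i ∈ J
    · simp only [cremonaFun, hi, if_true]; ring
    · simp [cremonaFun, hi]

theorem cremonaFun_add (n : ℕ) {s : ℕ} (J : Finset (Fin s)) (A B : Pic s) :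
    cremonaFun n J (A + B) = cremonaFun n J A + cremonaFun n J B := by
  refine Prod.ext ?_ (funext fun i => ?_)
  · simp only [cremonaFun, Prod.fst_add, Prod.snd_add, Pi.add_apply, Finset.sum_add_distrib]
    ring
  · by_cases hi : i ∈ J
    · simp only [cremonaFun, Prod.fst_add, Prod.snd_add, Pi.add_apply, Finset.sum_add_distrib,
        hi, if_true]
      ring
    · simp [cremonaFun, hi]

/-- The Cremona transformation based at the `n + 1` points indexed by `J`, as an automorphism
of the Picard group. -/
def cremona (n : ℕ) {s : ℕ} (J : Finset (Fin s)) (hJ : J.card = n + 1) : Pic s ≃+ Pic s where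
  toFun := cremonaFun n J
  invFun := cremonaFun n J
  left_inv := cremonaFun_involutive n J hJ
  right_inv := cremonaFun_involutive n J hJ
  map_add' := cremonaFun_add n J

/-- The permutation of the classes `E i` induced by a permutation of the points. -/
def permute {s : ℕ} (σ : Equiv.Perm (Fin s)) : Pic s ≃+ Pic s where
  toFun A := (A.1, fun i => A.2 (σ i))
  invFun A := (A.1, fun i => A.2 (σ.symm i))
  left_inv A := by simp
  right_inv A := by simp
  map_add' A B := rfl

/-- The Weyl group of the blow-up of `ℙⁿ` at `s` points, acting on the Picard group: it is
generated by the permutations of the points and the standard Cremona transformations based at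
any `n + 1` of the points. -/
def weylGroup (n s : ℕ) : Subgroup (Pic s ≃ₗ[ℤ] Pic s) :=
  Subgroup.closure
    ({w | ∃ σ : Equiv.Perm (Fin s), w = (permute σ).toIntLinearEquiv} ∪
      {w | ∃ (J : Finset (Fin s)) (hJ : J.card = n + 1), w = (cremona n J hJ).toIntLinearEquiv})

/-! ### Linear systems and their base loci -/

/-- The coefficient of the prime divisor `P` in `∑ i, m i • E i`. -/
def excCoeff {n s : ℕ} {p : Fin s → Pt n} (m : Fin s → ℤ) : PrimeDivisor p → ℤ
  | .strictTransform _ => 0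
  | .exceptional i => m i

/-- The linear system of the class `A = d H - ∑ i, m i • E i` on `X`: the effective divisors
`π^* (f = 0) - ∑ i, m i • E i`, where `f = 0` is a hypersurface of degree `d` in `ℙⁿ`.
Effectivity says exactly that the hypersurface has multiplicity at least `m i` at `p i` for
every `i`, so for `m ≥ 0` this is the linear system of hypersurfaces of degree `d` passing
through the points `p i` with multiplicities `m i`. -/
def linearSystem {n s : ℕ} (p : Fin s → Pt n) (A : Pic s) : Set (Divisor p) :=
  {Δ | 0 ≤ Δ ∧ ∃ (f : CoordRing n) (e : ℕ), f ≠ 0 ∧ f.IsHomogeneous e ∧ (e : ℤ) = A.1 ∧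
    ∀ P : PrimeDivisor p, Δ P = (pullbackOrd p f P : ℤ) - excCoeff A.2 P}

/-- The prime divisor `P` is contained with multiplicity (exactly) `k` in the base locus of the
linear system `L`: every member of `L` contains `P` with multiplicity at least `k`, and some
member contains it with multiplicity `k`. -/
def HasBaseMultiplicity {n s : ℕ} {p : Fin s → Pt n} (L : Set (Divisor p)) (P : PrimeDivisor p)
    (k : ℤ) : Prop :=
  IsLeast ((fun Δ : Divisor p => Δ P) '' L) k

end BlowUp

namespace BlowUp

/-! ### Vanishing orders -/

/-! For an exceptional divisor the claim is visible. If D has multiplicity m_i = ⟨D, E_i⟩ ≤ 0 at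
p_i, every member of the system contains -m_i E_i, and contains E_i no further as soon as its
hypersurface misses p_i. Since m_i ≤ 0 puts no condition at p_i, a general p_i lies off some
hypersurface of a nonempty system (`generic_exists_eval_ne_zero`, `generic_excClass`). The bilinear
form is W-invariant (`form_weylGroup`), so it remains to move the statement along W.

For this the statement is written purely in terms of the function A ↦ h0(A) on Pic
(`IsPrimeWithMultiplicity`); it then passes along every additive automorphism that matches
dimensions. Permutations relabel the points. For a Cremona transformation, choose coordinates in
which its base points are the coordinate points: reversing exponents of monomials identifies the
sections of A for one configuration with the sections of the transformed class for the transformed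
configuration, for all A at once (`h0_cremonaFun`). On configurations the transformation is a
polynomial map, involutive up to rescaling, so it pulls nonzero multihomogeneous polynomials back to
nonzero ones (`generic_cremona`). Hence validity for generic vectors is W-invariant
(`generic_weylGroup`).

To return to divisors, indecomposability of F forces its only member to be a prime divisor P. Let g
be its section. A section vanishing to order l along P is divisible by g ^ l, so comparing h0(D),
h0(D - kF) and h0(D - (k+1)F) decides the base multiplicity
(`IsPrimeWithMultiplicity.exists_hasBaseMultiplicity`). -/

theorem order_le_order_aeval {σ τ : Type*} (h : σ → MvPowerSeries τ ℂ)
    (hh : ∀ j, (h j).constantCoeff = 0) (g : MvPolynomial σ ℂ) :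
    MvPowerSeries.order (g : MvPowerSeries σ ℂ) ≤ MvPowerSeries.order (aeval h g) := by
  classical
  refine MvPowerSeries.le_order fun d hd => ?_
  rw [aeval_def, eval₂_eq, map_sum]
  refine Finset.sum_eq_zero fun a ha => MvPowerSeries.coeff_of_lt_order (hd.trans_le ?_)
  have h1 : MvPowerSeries.order (g : MvPowerSeries σ ℂ) ≤ (a.degree : ℕ∞) :=
    MvPowerSeries.order_le (by simpa [coeff_coe] using mem_support_iff.1 ha)
  refine h1.trans (le_trans ?_ MvPowerSeries.le_order_mul)
  refine le_trans ?_ le_add_self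
  refine le_trans ?_ (MvPowerSeries.le_order_prod _ _)
  rw [Finsupp.degree_apply, Nat.cast_sum]
  exact Finset.sum_le_sum fun j _ =>
    MvPowerSeries.le_order_pow_of_constantCoeff_eq_zero _ (hh j)

/-- The Taylor expansion of `f` at the vector `v`. -/
noncomputable def taylorAt {n : ℕ} (v : Fin (n + 1) → ℂ) :
    CoordRing n →ₐ[ℂ] MvPowerSeries (Fin (n + 1)) ℂ :=
  aeval fun j => MvPowerSeries.X j + MvPowerSeries.C (v j)

/-- The order of vanishing of `f` at the vector `v`. -/
noncomputable def ordAt {n : ℕ} (v : Fin (n + 1) → ℂ) (f : CoordRing n) : ℕ∞ :=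
  (taylorAt v f).order

theorem taylorAt_eq_coe {n : ℕ} (v : Fin (n + 1) → ℂ) (f : CoordRing n) :
    taylorAt v f = ((aeval (fun j => X j + C (v j)) f : CoordRing n) :
      MvPowerSeries (Fin (n + 1)) ℂ) := by
  induction f using MvPolynomial.induction_on with
  | C a => simp [taylorAt, MvPowerSeries.algebraMap_apply, MvPolynomial.algebraMap_eq]
  | add p q hp hq => rw [map_add, map_add, hp, hq, coe_add]
  | mul_X p j hp =>
    rw [map_mul, map_mul, hp, coe_mul]
    congr 1
    simp [taylorAt]

theorem taylorAt_ne_zero {n : ℕ} (v : Fin (n + 1) → ℂ) {f : CoordRing n} (hf : f ≠ 0) :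
    taylorAt v f ≠ 0 := by
  rw [taylorAt_eq_coe, Ne, coe_eq_zero_iff]
  intro h
  apply hf
  have : (aeval (fun j => X j + C (-v j)) (aeval (fun j => X j + C (v j)) f : CoordRing n) :
      CoordRing n) = f := by
    rw [← AlgHom.comp_apply, comp_aeval]
    simp [MvPolynomial.algebraMap_eq]
  rw [← this, h, map_zero]

theorem ordAt_eq_top_iff {n : ℕ} {v : Fin (n + 1) → ℂ} {f : CoordRing n} :
    ordAt v f = ⊤ ↔ f = 0 := by
  rw [ordAt, MvPowerSeries.order_eq_top_iff]
  refine ⟨fun h => ?_, fun h => by simp [h]⟩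
  by_contra hf
  exact taylorAt_ne_zero v hf h

theorem ordAt_mul {n : ℕ} (v : Fin (n + 1) → ℂ) (f g : CoordRing n) :
    ordAt v (f * g) = ordAt v f + ordAt v g := by
  rw [ordAt, map_mul, MvPowerSeries.order_mul]; rfl

theorem ordAt_C {n : ℕ} (v : Fin (n + 1) → ℂ) {a : ℂ} (ha : a ≠ 0) :
    ordAt v (C a : CoordRing n) = 0 := by
  rw [ordAt, taylorAt_eq_coe, aeval_C, MvPolynomial.algebraMap_eq, coe_C,
    ← MvPowerSeries.monomial_zero_eq_C_apply, MvPowerSeries.order_monomial_of_ne_zero ha]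
  simp

theorem natCast_le_ordAt_iff {n : ℕ} {v : Fin (n + 1) → ℂ} {f : CoordRing n} {k : ℕ} :
    (k : ℕ∞) ≤ ordAt v f ↔
      ∀ b, b.degree < k → coeff b (aeval (fun j => X j + C (v j)) f : CoordRing n) = 0 := by
  rw [ordAt, taylorAt_eq_coe]
  constructor
  · intro h b hb
    rw [← coeff_coe]
    exact MvPowerSeries.coeff_of_lt_order (lt_of_lt_of_le (by exact_mod_cast hb) h)
  · intro h
    exact MvPowerSeries.nat_le_order fun d hd => by rw [coeff_coe]; exact h d hd

/-- Orders of power series are additive on products and behave well under substitution, so all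
multiplicities are handled as `ordAt`. The zero form must be excluded: its order is ⊤, whereas `sInf
∅ = 0`. -/
theorem multAt_eq_ordAt {n : ℕ} (x : Pt n) {f : CoordRing n} (hf : f ≠ 0) :
    (multAt x f : ℕ∞) = ordAt x.rep f := by
  set g : CoordRing n := aeval (fun j => X j + C (x.rep j)) f with hg
  obtain ⟨m, hm⟩ : ∃ m : ℕ, ordAt x.rep f = m :=
    ⟨_, (ENat.natCast_toNat (mt ordAt_eq_top_iff.1 hf)).symm⟩
  have hlow : ∀ b, b.degree < m → coeff b g = 0 := natCast_le_ordAt_iff.1 hm.ge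
  have hne : homogeneousComponent m g ≠ 0 := by
    intro h0
    have : ((m + 1 : ℕ) : ℕ∞) ≤ ordAt x.rep f := by
      refine natCast_le_ordAt_iff.2 fun b hb => ?_
      rcases Nat.lt_succ_iff_lt_or_eq.1 hb with h | h
      · exact hlow b h
      · have := congrArg (coeff b) h0
        rwa [coeff_homogeneousComponent, if_pos h, coeff_zero] at this
    rw [hm] at this
    have := ENat.natCast_le_natCast.1 this
    omega
  rw [hm]
  congr 1
  refine le_antisymm (Nat.sInf_le hne) (le_csInf ⟨m, hne⟩ fun k hk => ?_)
  by_contra! hlt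
  refine hk (MvPolynomial.ext _ _ fun b => ?_)
  rw [coeff_homogeneousComponent]
  split_ifs with h
  · rw [coeff_zero]; exact hlow b (h ▸ hlt)
  · simp

/-- Vanishing orders do not decrease under substitution of power series with constant terms `v`. -/
theorem ordAt_le_order_aeval {n : ℕ} (v : Fin (n + 1) → ℂ)
    (u : Fin (n + 1) → MvPowerSeries (Fin (n + 1)) ℂ) (hu : ∀ j, (u j).constantCoeff = v j)
    (f : CoordRing n) : ordAt v f ≤ (aeval u f).order := by
  rw [ordAt, taylorAt_eq_coe]
  refine (order_le_order_aeval (fun j => u j - MvPowerSeries.C (v j)) (by simp [hu]) _).trans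
    (le_of_eq ?_)
  rw [← AlgHom.comp_apply, comp_aeval]
  congr 2
  ext1 j
  simp [← MvPowerSeries.c_eq_algebraMap]

theorem aeval_smul_of_isHomogeneous {σ S : Type*} [CommRing S] [Algebra ℂ S] {f : MvPolynomial σ ℂ}
    {e : ℕ} (hf : f.IsHomogeneous e) (c : ℂ) (u : σ → S) :
    aeval (fun j => c • u j) f = c ^ e • aeval u f := by
  rw [aeval_def, aeval_def, eval₂_eq, eval₂_eq, Finset.smul_sum]
  refine Finset.sum_congr rfl fun a ha => ?_
  have : ∑ i ∈ a.support, a i = e := by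
    rw [← Finsupp.degree_apply]
    by_contra h
    exact mem_support_iff.1 ha (hf.coeff_eq_zero h)
  simp only [smul_pow, Finset.prod_smul, Finset.prod_pow_eq_pow_sum, this, mul_smul_comm]

/-- The series c⁻¹(x + cv) has constant terms v, and by homogeneity substituting it in `f` gives the
Taylor expansion at cv up to a scalar. This makes multiplicities independent of representatives. -/
theorem ordAt_le_ordAt_smul {n e : ℕ} {f : CoordRing n} (hf : f.IsHomogeneous e) {c : ℂ}
    (hc : c ≠ 0) (v : Fin (n + 1) → ℂ) : ordAt v f ≤ ordAt (c • v) f := by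
  refine (ordAt_le_order_aeval v
    (fun j => c⁻¹ • (MvPowerSeries.X j + MvPowerSeries.C ((c • v) j))) (fun j => ?_) f).trans ?_
  · simp [MvPowerSeries.smul_eq_C_mul, hc]
  · rw [aeval_smul_of_isHomogeneous hf]
    have h := MvPowerSeries.le_order_smul (a := c ^ e) (f := c⁻¹ ^ e • taylorAt (c • v) f)
    rwa [smul_smul, ← mul_pow, mul_inv_cancel₀ hc, one_pow, one_smul] at h

theorem ordAt_smul {n e : ℕ} {f : CoordRing n} (hf : f.IsHomogeneous e) {c : ℂ}
    (hc : c ≠ 0) (v : Fin (n + 1) → ℂ) : ordAt (c • v) f = ordAt v f := by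
  refine le_antisymm ?_ (ordAt_le_ordAt_smul hf hc v)
  have := ordAt_le_ordAt_smul hf (inv_ne_zero hc) (c • v)
  rwa [inv_smul_smul₀ hc] at this

/-- Substitution of the linear forms given by the rows of a matrix. -/
noncomputable def linSubst {n : ℕ} (M : Matrix (Fin (n + 1)) (Fin (n + 1)) ℂ) :
    CoordRing n →ₐ[ℂ] CoordRing n :=
  aeval fun k => ∑ l, C (M k l) * X l

theorem linSubst_linSubst {n : ℕ} (M N : Matrix (Fin (n + 1)) (Fin (n + 1)) ℂ) (f : CoordRing n) :
    linSubst M (linSubst N f) = linSubst (N * M) f := by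
  rw [linSubst, linSubst, linSubst, ← AlgHom.comp_apply, comp_aeval]
  congr 2
  ext1 k
  simp only [map_sum, map_mul, aeval_C, aeval_X, MvPolynomial.algebraMap_eq, Matrix.mul_apply,
    Finset.mul_sum, Finset.sum_mul]
  rw [Finset.sum_comm]
  simp only [mul_assoc]

theorem linSubst_one {n : ℕ} (f : CoordRing n) : linSubst 1 f = f := by
  have : (fun k : Fin (n + 1) => ∑ l, C ((1 : Matrix (Fin (n + 1)) (Fin (n + 1)) ℂ) k l) * X l)
      = (X : Fin (n + 1) → CoordRing n) := by
    ext1 k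
    simp [Matrix.one_apply, apply_ite C, ite_mul]
  rw [linSubst, this, aeval_X_left_apply]

theorem isHomogeneous_linSubst {n e : ℕ} (M : Matrix (Fin (n + 1)) (Fin (n + 1)) ℂ)
    {f : CoordRing n} (hf : f.IsHomogeneous e) : (linSubst M f).IsHomogeneous e := by
  have := hf.aeval (fun k => ∑ l, C (M k l) * X l : Fin (n + 1) → CoordRing n) (n := 1)
    (fun k => IsHomogeneous.sum _ _ _ fun l _ => isHomogeneous_C_mul_X _ _)
  rwa [one_mul] at this

/-- The Taylor expansion at v of the transformed polynomial is `f` with M(x + v) substituted, whose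
constant terms are Mv. -/
theorem ordAt_le_ordAt_linSubst {n : ℕ} (M : Matrix (Fin (n + 1)) (Fin (n + 1)) ℂ)
    (v : Fin (n + 1) → ℂ) (f : CoordRing n) :
    ordAt (M.mulVec v) f ≤ ordAt v (linSubst M f) := by
  refine (ordAt_le_order_aeval _
    (fun k => ∑ l, MvPowerSeries.C (M k l) * (MvPowerSeries.X l + MvPowerSeries.C (v l)))
    (fun k => ?_) f).trans (le_of_eq ?_)
  · simp [Matrix.mulVec, dotProduct]
  · rw [ordAt, taylorAt, linSubst, ← AlgHom.comp_apply, comp_aeval]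
    simp [← MvPowerSeries.c_eq_algebraMap]

/-- Reversal of the exponents of a polynomial, with respect to the exponent `b`. -/
noncomputable def reverseExp {n : ℕ} (b : Fin (n + 1) →₀ ℕ) : CoordRing n →ₗ[ℂ] CoordRing n :=
  (basisMonomials (Fin (n + 1)) ℂ).constr ℂ fun a => monomial (b - a) 1

theorem reverseExp_monomial {n : ℕ} (a b : Fin (n + 1) →₀ ℕ) (c : ℂ) :
    reverseExp b (monomial a c) = monomial (b - a) c := by
  have h : (monomial a c : CoordRing n) = c • basisMonomials (Fin (n + 1)) ℂ a := by
    simp [smul_monomial]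
  rw [h, map_smul, reverseExp, Module.Basis.constr_basis, smul_monomial, smul_eq_mul, mul_one]

theorem reverseExp_apply {n : ℕ} (b : Fin (n + 1) →₀ ℕ) (f : CoordRing n) :
    reverseExp b f = ∑ a ∈ f.support, monomial (b - a) (coeff a f) := by
  conv_lhs => rw [f.as_sum, map_sum]
  simp only [reverseExp_monomial]

theorem exists_of_mem_support_reverseExp {n : ℕ} {b a : Fin (n + 1) →₀ ℕ} {f : CoordRing n}
    (ha : a ∈ (reverseExp b f).support) : ∃ a' ∈ f.support, a = b - a' := by
  classical
  rw [reverseExp_apply] at ha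
  obtain ⟨a', ha', h⟩ := Finset.mem_biUnion.1 (support_sum ha)
  exact ⟨a', ha', Finset.mem_singleton.1 (support_monomial_subset h)⟩

theorem reverseExp_reverseExp {n : ℕ} {b : Fin (n + 1) →₀ ℕ} {f : CoordRing n}
    (hf : ∀ a ∈ f.support, a ≤ b) : reverseExp b (reverseExp b f) = f := by
  rw [reverseExp_apply b f, map_sum]
  conv_rhs => rw [f.as_sum]
  refine Finset.sum_congr rfl fun a ha => ?_
  rw [reverseExp_monomial, tsub_tsub_cancel_of_le (hf a ha)]

/-- Coordinatewise inversion preserves vanishing orders at points off the coordinate hyperplanes. -/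
theorem ordAt_le_ordAt_reverseExp {n : ℕ} {b : Fin (n + 1) →₀ ℕ} {f : CoordRing n}
    (hf : ∀ a ∈ f.support, a ≤ b) {v w : Fin (n + 1) → ℂ} (hv : ∀ k, v k ≠ 0)
    (hw : ∀ k, w k = (v k)⁻¹) : ordAt v f ≤ ordAt w (reverseExp b f) := by
  set U : Fin (n + 1) → MvPowerSeries (Fin (n + 1)) ℂ :=
    fun j => MvPowerSeries.X j + MvPowerSeries.C (w j) with hU
  have hc : ∀ j, (U j).constantCoeff = w j := fun j => by simp [hU]
  have hne : ∀ j, (U j).constantCoeff ≠ 0 := fun j => by rw [hc, hw]; exact inv_ne_zero (hv j)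
  have hinv : ∀ j, (U j)⁻¹ * U j = 1 := fun j => MvPowerSeries.inv_mul_cancel _ (hne j)
  -- Exponent reversal is f ↦ x^b f(1/x). It makes sense for power series here because each `U j`
  -- has nonzero constant term.
  have key : taylorAt w (reverseExp b f) = (∏ j, U j ^ b j) * aeval (fun j => (U j)⁻¹) f := by
    rw [reverseExp_apply, map_sum, aeval_def, eval₂_eq', Finset.mul_sum]
    refine Finset.sum_congr rfl fun a ha => ?_
    rw [taylorAt, aeval_monomial, mul_left_comm, ← Finset.prod_mul_distrib,
      Finsupp.prod_fintype _ _ (fun _ => pow_zero _)]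
    congr 1
    refine Finset.prod_congr rfl fun j _ => ?_
    have hj : b j = (b - a) j + a j := by
      rw [Finsupp.tsub_apply, Nat.sub_add_cancel (hf a ha j)]
    rw [hj, pow_add, mul_assoc, ← mul_pow, mul_comm (U j), hinv, one_pow, mul_one]
  refine (ordAt_le_order_aeval v (fun j => (U j)⁻¹) (fun j => ?_) f).trans ?_
  · rw [MvPowerSeries.constantCoeff_inv, hc, hw, inv_inv]
  · rw [ordAt, key, MvPowerSeries.order_mul]
    exact le_add_self

/-- The multiplicity of a form at a coordinate point is read off from its exponents. -/
theorem natCast_le_ordAt_single_iff {n e : ℕ} {f : CoordRing n} (hf : f.IsHomogeneous e)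
    (j : Fin (n + 1)) (k : ℕ) :
    (k : ℕ∞) ≤ ordAt (Pi.single j 1) f ↔ ∀ a ∈ f.support, a j + k ≤ e := by
  classical
  have hdeg : ∀ a ∈ f.support, a j + (a.erase j).degree = e := by
    intro a ha
    have h1 : a.degree = e := by
      by_contra h
      exact mem_support_iff.1 ha (hf.coeff_eq_zero h)
    conv_rhs => rw [← h1, ← Finsupp.single_add_erase j a, map_add, Finsupp.degree_single]
  constructor
  · intro h a ha
    -- Dehomogenise by x_j = 1. Distinct monomials of `f` stay distinct, since the common degree e
    -- recovers the erased exponent; so no coefficient cancels.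
    set u : Fin (n + 1) → MvPowerSeries (Fin (n + 1)) ℂ :=
      fun l => if l = j then 1 else MvPowerSeries.X l with hu
    have h1 := h.trans (ordAt_le_order_aeval _ u (fun l => by
      by_cases hl : l = j <;> simp [hu, hl]) f)
    have h2 : MvPowerSeries.coeff (a.erase j) (aeval u f) = coeff a f := by
      have hmon : ∀ a' : Fin (n + 1) →₀ ℕ, ∀ c : ℂ, aeval u (monomial a' c) =
          MvPowerSeries.monomial (a'.erase j) c := by
        intro a' c
        rw [aeval_monomial, ← coe_monomial, monomial_eq, coe_mul, coe_C,
          Finsupp.prod_fintype _ _ (fun _ => pow_zero _),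
          Finsupp.prod_fintype _ _ (fun _ => pow_zero _),
          ← coeToMvPowerSeries.ringHom_apply (∏ i, _), map_prod]
        congr 1
        refine Finset.prod_congr rfl fun l _ => ?_
        by_cases hl : l = j
        · simp [hu, hl]
        · simp [hu, hl, Finsupp.erase_ne]
      conv_lhs => rw [f.as_sum]
      rw [map_sum, map_sum, Finset.sum_eq_single a]
      · rw [hmon, MvPowerSeries.coeff_monomial_same]
      · intro a' ha' hne
        rw [hmon, MvPowerSeries.coeff_monomial_ne]
        intro heq
        apply hne
        have h3 := hdeg a ha
        have h4 := hdeg a' ha'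
        rw [← heq] at h4
        rw [← Finsupp.single_add_erase j a, ← Finsupp.single_add_erase j a', heq,
          show a j = a' j by omega]
      · intro h; exact absurd ha h
    have h3 := h1.trans (MvPowerSeries.order_le (d := a.erase j)
      (by rw [h2]; exact mem_support_iff.1 ha))
    have h4 := hdeg a ha
    have h5 : k ≤ (a.erase j).degree := by exact_mod_cast h3
    omega
  · intro h
    refine MvPowerSeries.nat_le_order fun d hd => ?_
    rw [f.as_sum, map_sum, map_sum]
    refine Finset.sum_eq_zero fun a ha => MvPowerSeries.coeff_of_lt_order ?_
    refine lt_of_lt_of_le (Nat.cast_lt.2 hd) ?_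
    -- At the coordinate point each X_l with l ≠ j keeps order 1, while X_j becomes 1 + X_j and
    -- contributes nothing.
    have h1 : k ≤ (a.erase j).degree := by have := hdeg a ha; have := h a ha; omega
    refine (Nat.cast_le.2 h1).trans ?_
    rw [taylorAt, aeval_monomial, Finsupp.prod_fintype _ _ (fun _ => pow_zero _)]
    refine le_trans (le_trans ?_ (MvPowerSeries.le_order_prod _ _))
      (le_trans le_add_self MvPowerSeries.le_order_mul)
    rw [Finsupp.degree_eq_sum, Nat.cast_sum]
    refine Finset.sum_le_sum fun l _ => ?_
    by_cases hl : l = j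
    · simp [hl]
    · rw [Finsupp.erase_ne hl]
      exact MvPowerSeries.le_order_pow_of_constantCoeff_eq_zero _ (by simp [hl])

/-! ### Sections of a class and their dimension -/

/-- The forms of degree `d` that vanish to order at least `m i` at the vectors `v i`, where
`A = (d, m)`. -/
noncomputable def sections {n s : ℕ} (v : Fin s → Fin (n + 1) → ℂ) (A : Pic s) :
    Submodule ℂ (CoordRing n) where
  -- Degrees are compared in ℤ, so a class of negative degree has only the zero section. By `toNat`,
  -- a negative m_i imposes no condition: -m_i E_i is then a fixed part.
  carrier := {f | (∀ a ∈ f.support, (a.degree : ℤ) = A.1) ∧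
    ∀ i, ((A.2 i).toNat : ℕ∞) ≤ ordAt (v i) f}
  zero_mem' := ⟨by simp, fun i => by simp [ordAt_eq_top_iff.2 rfl]⟩
  add_mem' := by
    classical
    rintro f g ⟨hf, hf'⟩ ⟨hg, hg'⟩
    refine ⟨fun a ha => ?_, fun i => ?_⟩
    · rcases Finset.mem_union.1 (support_add ha) with h | h
      exacts [hf a h, hg a h]
    · rw [ordAt, map_add]
      exact (le_min (hf' i) (hg' i)).trans MvPowerSeries.min_order_le_add
  smul_mem' := by
    rintro c f ⟨hf, hf'⟩
    refine ⟨fun a ha => hf a (support_smul ha), fun i => ?_⟩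
    rw [ordAt, map_smul]
    exact (hf' i).trans MvPowerSeries.le_order_smul

theorem isHomogeneous_of_mem_sections {n s : ℕ} {v : Fin s → Fin (n + 1) → ℂ} {A : Pic s}
    {f : CoordRing n} (hf : f ∈ sections v A) : f.IsHomogeneous A.1.toNat := by
  rw [← mem_homogeneousSubmodule, homogeneousSubmodule_eq_finsupp_supported]
  intro a ha
  have := hf.1 a ha
  simp only [Set.mem_ofPred_eq]
  omega

theorem fst_eq_of_mem_sections {n s : ℕ} {v : Fin s → Fin (n + 1) → ℂ} {A : Pic s}
    {f : CoordRing n} (hf : f ∈ sections v A) (h0 : f ≠ 0) : (A.1.toNat : ℤ) = A.1 := by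
  obtain ⟨a, ha⟩ := MvPolynomial.support_nonempty.2 h0
  have := hf.1 a ha
  omega

theorem mem_sections_of_isHomogeneous {n s : ℕ} {v : Fin s → Fin (n + 1) → ℂ} {A : Pic s}
    {f : CoordRing n} {e : ℕ} (hf : f.IsHomogeneous e) (he : (e : ℤ) = A.1)
    (h : ∀ i, ((A.2 i).toNat : ℕ∞) ≤ ordAt (v i) f) : f ∈ sections v A := by
  refine ⟨fun a ha => ?_, h⟩
  rw [← he]
  by_contra hne
  exact mem_support_iff.1 ha (hf.coeff_eq_zero fun h => hne (by exact_mod_cast h))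

instance finite_sections {n s : ℕ} (v : Fin s → Fin (n + 1) → ℂ) (A : Pic s) :
    Module.Finite ℂ (sections v A) := by
  have hfin : Module.Finite ℂ (homogeneousSubmodule (Fin (n + 1)) ℂ A.1.toNat) :=
    Module.Finite.iff_fg.2 (homogeneousSubmodule_fg _ _ _)
  have hle : sections v A ≤ homogeneousSubmodule (Fin (n + 1)) ℂ A.1.toNat :=
    fun f hf => isHomogeneous_of_mem_sections hf
  exact Module.Finite.of_injective (Submodule.inclusion hle) (Submodule.inclusion_injective hle)

/-- The dimension of the space of sections of a class. -/
noncomputable def h0 {n s : ℕ} (v : Fin s → Fin (n + 1) → ℂ) (A : Pic s) : ℕ :=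
  Module.finrank ℂ (sections v A)

theorem h0_ne_zero_iff {n s : ℕ} {v : Fin s → Fin (n + 1) → ℂ} {A : Pic s} :
    h0 v A ≠ 0 ↔ ∃ f ∈ sections v A, f ≠ 0 := by
  rw [h0, Ne, Submodule.finrank_eq_zero]
  exact Submodule.ne_bot_iff _

theorem h0_le_of_linearMap {n s : ℕ} {v w : Fin s → Fin (n + 1) → ℂ} {A B : Pic s}
    (T : CoordRing n →ₗ[ℂ] CoordRing n) (hT : ∀ f ∈ sections v A, T f ∈ sections w B)
    (hinj : ∀ f ∈ sections v A, T f = 0 → f = 0) : h0 v A ≤ h0 w B := by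
  refine LinearMap.finrank_le_finrank_of_injective (f := T.restrict hT) ?_
  rw [injective_iff_map_eq_zero]
  rintro ⟨f, hf⟩ h
  exact Subtype.ext (hinj f hf (congrArg Subtype.val h))

theorem sections_smul {n s : ℕ} (v : Fin s → Fin (n + 1) → ℂ) {t : Fin s → ℂ}
    (ht : ∀ i, t i ≠ 0) (A : Pic s) : sections (fun i => t i • v i) A = sections v A := by
  ext f
  constructor <;> intro hf <;>
    have hom := isHomogeneous_of_mem_sections hf <;>
    refine ⟨hf.1, fun i => ?_⟩ <;> have := hf.2 i
  · rwa [ordAt_smul hom (ht i)] at this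
  · rwa [ordAt_smul hom (ht i)]

theorem h0_smul {n s : ℕ} (v : Fin s → Fin (n + 1) → ℂ) {t : Fin s → ℂ}
    (ht : ∀ i, t i ≠ 0) : h0 (fun i => t i • v i) = h0 v := by
  ext A
  rw [h0, sections_smul v ht, h0]

theorem h0_mulVec_le {n s : ℕ} (v : Fin s → Fin (n + 1) → ℂ)
    {M N : Matrix (Fin (n + 1)) (Fin (n + 1)) ℂ} (hMN : M * N = 1) (A : Pic s) :
    h0 (fun i => M.mulVec (v i)) A ≤ h0 v A := by
  refine h0_le_of_linearMap (linSubst M).toLinearMap (fun f hf => ?_) fun f _ h => ?_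
  · by_cases h0 : f = 0
    · simp [h0]
    · exact mem_sections_of_isHomogeneous
        (isHomogeneous_linSubst M (isHomogeneous_of_mem_sections hf))
        (fst_eq_of_mem_sections hf h0)
        fun i => (hf.2 i).trans (ordAt_le_ordAt_linSubst M (v i) f)
  · have h1 : linSubst N (linSubst M f) = 0 := by
      rw [show linSubst M f = 0 from h, map_zero]
    rwa [linSubst_linSubst, hMN, linSubst_one] at h1

/-- Projective transformations preserve the dimensions of linear systems. -/
theorem h0_mulVec {n s : ℕ} (v : Fin s → Fin (n + 1) → ℂ)
    {M N : Matrix (Fin (n + 1)) (Fin (n + 1)) ℂ} (hMN : M * N = 1) :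
    h0 (fun i => M.mulVec (v i)) = h0 v := by
  ext A
  refine le_antisymm (h0_mulVec_le v hMN A) ?_
  have hNM : N * M = 1 := mul_eq_one_comm.1 hMN
  have := h0_mulVec_le (fun i => M.mulVec (v i)) hNM A
  simpa only [Matrix.mulVec_mulVec, hNM, Matrix.one_mulVec] using this

theorem h0_permute {n s : ℕ} (v : Fin s → Fin (n + 1) → ℂ) (σ : Equiv.Perm (Fin s)) (A : Pic s) :
    h0 v (permute σ A) = h0 (v ∘ σ.symm) A := by
  have : sections v (permute σ A) = sections (v ∘ σ.symm) A := by
    ext f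
    refine and_congr Iff.rfl (σ.forall_congr fun {i} => ?_)
    simp [permute]
  rw [h0, this, h0]

/-- Put b_k = d - m_k at the base points. Their conditions bound exponents by a ≤ b, which is
symmetric under a ↦ b - a. At the other points this map is coordinatewise inversion up to a monomial
factor, so multiplicities survive. The new degree is the sum of the b_k minus d, which is the
Cremona degree. -/
theorem h0_le_h0_cremonaFun {n s : ℕ} (ι : Fin (n + 1) ↪ Fin s) {u w : Fin s → Fin (n + 1) → ℂ}
    (hu : ∀ k, u (ι k) = Pi.single k 1) (hw : ∀ k, w (ι k) = Pi.single k 1)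
    (hne : ∀ i ∉ Set.range ι, ∀ l, u i l ≠ 0)
    (hinv : ∀ i ∉ Set.range ι, ∀ l, w i l = (u i l)⁻¹) (A : Pic s) :
    h0 u A ≤ h0 w (cremonaFun n (Finset.univ.map ι) A) := by
  -- Truncation is harmless: one monomial in a section already forces d - m_k ≥ 0.
  set b : Fin (n + 1) →₀ ℕ := Finsupp.equivFunOnFinite.symm fun k => (A.1 - A.2 (ι k)).toNat with hb
  have hsum : ∑ j ∈ Finset.univ.map ι, A.2 j = ∑ k, A.2 (ι k) := Finset.sum_map _ _ _
  have hbound : ∀ f ∈ sections u A, ∀ a ∈ f.support, ∀ k, (a k : ℤ) ≤ A.1 - A.2 (ι k) := by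
    intro f hf a ha k
    have h1 := hf.2 (ι k)
    rw [hu, natCast_le_ordAt_single_iff (isHomogeneous_of_mem_sections hf)] at h1
    have h2 := h1 a ha
    have h3 := hf.1 a ha
    omega
  have hbk : ∀ f ∈ sections u A, ∀ a ∈ f.support, ∀ k, (b k : ℤ) = A.1 - A.2 (ι k) := by
    intro f hf a ha k
    have := hbound f hf a ha k
    simp only [hb, Finsupp.coe_equivFunOnFinite_symm]
    omega
  have hab : ∀ f ∈ sections u A, ∀ a ∈ f.support, a ≤ b := by
    intro f hf a ha k
    have := hbound f hf a ha k
    have := hbk f hf a ha k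
    omega
  refine h0_le_of_linearMap (reverseExp b) (fun f hf => ?_) fun f hf h => ?_
  · have hdeg : ∀ a ∈ (reverseExp b f).support,
        (a.degree : ℤ) = (cremonaFun n (Finset.univ.map ι) A).1 := by
      intro a' ha'
      obtain ⟨a, ha, rfl⟩ := exists_of_mem_support_reverseExp ha'
      have h1 : ((b - a).degree : ℤ) = ∑ k, (A.1 - A.2 (ι k) - a k) := by
        rw [Finsupp.degree_eq_sum, Nat.cast_sum]
        refine Finset.sum_congr rfl fun k _ => ?_
        rw [Finsupp.tsub_apply, Nat.cast_sub (hab f hf a ha k), hbk f hf a ha]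
      have h2 : ∑ k, (a k : ℤ) = A.1 := by
        rw [← hf.1 a ha, Finsupp.degree_eq_sum, Nat.cast_sum]
      rw [h1, Finset.sum_sub_distrib, Finset.sum_sub_distrib, h2]
      simp only [cremonaFun, hsum, Finset.sum_const, Finset.card_univ, Fintype.card_fin,
        nsmul_eq_mul]
      push_cast
      ring
    refine ⟨hdeg, fun i => ?_⟩
    by_cases hi : i ∈ Set.range ι
    · obtain ⟨k, rfl⟩ := hi
      have hom : (reverseExp b f).IsHomogeneous (cremonaFun n (Finset.univ.map ι) A).1.toNat := by
        rw [← mem_homogeneousSubmodule, homogeneousSubmodule_eq_finsupp_supported]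
        intro a ha
        have := hdeg a ha
        simp only [Set.mem_ofPred_eq]
        omega
      rw [hw, natCast_le_ordAt_single_iff hom]
      intro a' ha'
      have h1 := hdeg a' ha'
      have h2 : a' k ≤ a'.degree := Finsupp.le_degree k a'
      obtain ⟨a, ha, rfl⟩ := exists_of_mem_support_reverseExp ha'
      have h3 := hbk f hf a ha k
      have h4 : (b - a) k ≤ b k := by rw [Finsupp.tsub_apply]; omega
      -- The difference d - m_k is unchanged at a base point, so b still bounds the new exponents as
      -- required. If the new multiplicity is negative, the degree bound `h2` suffices.
      have h5 : (cremonaFun n (Finset.univ.map ι) A).2 (ι k)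
          = A.2 (ι k) + (cremonaFun n (Finset.univ.map ι) A).1 - A.1 := by
        have : ι k ∈ Finset.univ.map ι := Finset.mem_map_of_mem _ (Finset.mem_univ k)
        simp only [cremonaFun, this, if_true]
        ring
      omega
    · have h1 : i ∉ Finset.univ.map ι := by simpa using hi
      have h2 : (cremonaFun n (Finset.univ.map ι) A).2 i = A.2 i := by
        simp only [cremonaFun, h1, if_false]
      rw [h2]
      exact (hf.2 i).trans (ordAt_le_ordAt_reverseExp (hab f hf) (hne i hi) (hinv i hi))
  · rw [← reverseExp_reverseExp (hab f hf), h, map_zero]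

/-- The standard Cremona transformation preserves the dimensions of linear systems. -/
theorem h0_cremonaFun {n s : ℕ} (ι : Fin (n + 1) ↪ Fin s) {u w : Fin s → Fin (n + 1) → ℂ}
    (hu : ∀ k, u (ι k) = Pi.single k 1) (hw : ∀ k, w (ι k) = Pi.single k 1)
    (hne : ∀ i ∉ Set.range ι, ∀ l, u i l ≠ 0)
    (hinv : ∀ i ∉ Set.range ι, ∀ l, w i l = (u i l)⁻¹) (A : Pic s) :
    h0 w (cremonaFun n (Finset.univ.map ι) A) = h0 u A := by
  refine le_antisymm ?_ (h0_le_h0_cremonaFun ι hu hw hne hinv A)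
  have := h0_le_h0_cremonaFun ι hw hu (fun i hi l => by rw [hinv i hi]; exact inv_ne_zero (hne i hi l))
    (fun i hi l => by rw [hinv i hi, inv_inv]) (cremonaFun n (Finset.univ.map ι) A)
  rwa [cremonaFun_involutive n _ (by simp) A] at this

/-! ### Generic vectors -/

/-- `P` holds for generic vectors: it holds where some nonzero polynomial does not vanish. -/
def Generic {n s : ℕ} (P : (Fin s → Fin (n + 1) → ℂ) → Prop) : Prop :=
  ∃ g : MvPolynomial (Fin s × Fin (n + 1)) ℂ, g ≠ 0 ∧
    ∀ v : Fin s → Fin (n + 1) → ℂ, eval (fun ij => v ij.1 ij.2) g ≠ 0 → P v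

theorem exists_eval_ne_zero {σ : Type*} {g : MvPolynomial σ ℂ} (hg : g ≠ 0) :
    ∃ x, eval x g ≠ 0 := by
  by_contra! h
  exact hg (MvPolynomial.funext fun x => by rw [h x, map_zero])

/-- The multidegree weights of the coordinates of `s` points. -/
noncomputable def multiWeight (n s : ℕ) : Fin s × Fin (n + 1) → (Fin s →₀ ℕ) :=
  fun ij => Finsupp.single ij.1 1

theorem aeval_scale_monomial {n s : ℕ} (v : Fin s × Fin (n + 1) → ℂ)
    (a : Fin s × Fin (n + 1) →₀ ℕ) (c : ℂ) :
    aeval (fun ij => C (v ij) * X ij.1 : _ → MvPolynomial (Fin s) ℂ) (monomial a c) =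
      monomial (Finsupp.weight (multiWeight n s) a) (eval v (monomial a c)) := by
  rw [aeval_monomial, eval_monomial, MvPolynomial.algebraMap_eq, Finsupp.prod, Finsupp.prod,
    Finsupp.weight_apply, Finsupp.sum, ← mul_one (c * _), ← C_mul_monomial, monomial_sum_one,
    map_mul, mul_assoc]
  congr 1
  rw [map_prod, ← Finset.prod_mul_distrib]
  refine Finset.prod_congr rfl fun ij _ => ?_
  rw [mul_pow, map_pow, multiWeight, Finsupp.smul_single, smul_eq_mul, mul_one, X_pow_eq_monomial]

theorem eval_scale {n s : ℕ} (v : Fin s → Fin (n + 1) → ℂ) (t : Fin s → ℂ)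
    (g : MvPolynomial (Fin s × Fin (n + 1)) ℂ) :
    eval (fun ij => (t ij.1 • v ij.1) ij.2) g =
      eval t (aeval (fun ij => C (v ij.1 ij.2) * X ij.1 : _ → MvPolynomial (Fin s) ℂ) g) := by
  induction g using MvPolynomial.induction_on with
  | C a => simp
  | add p q hp hq => rw [map_add, map_add, map_add, hp, hq]
  | mul_X p j hp => rw [map_mul, map_mul, map_mul, hp]; simp [mul_comm]

theorem aeval_scale_of_isWeightedHomogeneous {n s : ℕ} (v : Fin s × Fin (n + 1) → ℂ)
    {g : MvPolynomial (Fin s × Fin (n + 1)) ℂ} {e : Fin s →₀ ℕ}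
    (hg : IsWeightedHomogeneous (multiWeight n s) g e) :
    aeval (fun ij => C (v ij) * X ij.1 : _ → MvPolynomial (Fin s) ℂ) g = monomial e (eval v g) := by
  rw [g.as_sum, map_sum, map_sum, map_sum]
  refine Finset.sum_congr rfl fun a ha => ?_
  rw [aeval_scale_monomial, hg (mem_support_iff.1 ha)]

theorem eval_scale_ne_zero {n s : ℕ} (v : Fin s → Fin (n + 1) → ℂ) {t : Fin s → ℂ}
    (ht : ∀ i, t i ≠ 0) {g : MvPolynomial (Fin s × Fin (n + 1)) ℂ} {e : Fin s →₀ ℕ}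
    (hg : IsWeightedHomogeneous (multiWeight n s) g e)
    (h : eval (fun ij => v ij.1 ij.2) g ≠ 0) :
    eval (fun ij => (t ij.1 • v ij.1) ij.2) g ≠ 0 := by
  rw [eval_scale, aeval_scale_of_isWeightedHomogeneous (fun ij => v ij.1 ij.2) hg, eval_monomial]
  exact mul_ne_zero h (Finset.prod_ne_zero_iff.2 fun i _ => pow_ne_zero _ (ht i))

/-- Rescaling the i-th vector by an indeterminate t_i separates multidegrees: the coefficient of t^e
in g(t·v) is the value at v of the component of multidegree e. -/
theorem coeff_aeval_scale {n s : ℕ} (v : Fin s × Fin (n + 1) → ℂ)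
    (g : MvPolynomial (Fin s × Fin (n + 1)) ℂ) (e : Fin s →₀ ℕ) :
    coeff e (aeval (fun ij => C (v ij) * X ij.1 : _ → MvPolynomial (Fin s) ℂ) g) =
      eval v (weightedHomogeneousComponent (multiWeight n s) e g) := by
  classical
  rw [weightedHomogeneousComponent_apply, map_sum, Finset.sum_filter]
  conv_lhs => rw [g.as_sum, map_sum, coeff_sum]
  refine Finset.sum_congr rfl fun a _ => ?_
  rw [aeval_scale_monomial, coeff_monomial]

theorem isMultihomogeneous_of_isWeightedHomogeneous {n s : ℕ}
    {g : MvPolynomial (Fin s × Fin (n + 1)) ℂ} {e : Fin s →₀ ℕ}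
    (hg : IsWeightedHomogeneous (multiWeight n s) g e) : IsMultihomogeneous g := by
  refine fun i => ⟨e i, fun a ha => ?_⟩
  rw [← hg ha, Finsupp.weight_apply, Finsupp.weight_apply, Finsupp.sum, Finsupp.sum,
    Finsupp.finsetSum_apply]
  refine Finset.sum_congr rfl fun ij _ => ?_
  simp [multiWeight, Finsupp.single_apply]

/-- A generic property that is invariant under rescaling holds where a nonzero multihomogeneous
polynomial does not vanish. -/
theorem Generic.exists_isWeightedHomogeneous {n s : ℕ} {P : (Fin s → Fin (n + 1) → ℂ) → Prop}
    (hP : Generic P)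
    (hscale : ∀ (v : Fin s → Fin (n + 1) → ℂ) (t : Fin s → ℂ), (∀ i, t i ≠ 0) →
      P (fun i => t i • v i) → P v) :
    ∃ (g : MvPolynomial (Fin s × Fin (n + 1)) ℂ) (e : Fin s →₀ ℕ), g ≠ 0 ∧
      IsWeightedHomogeneous (multiWeight n s) g e ∧
      ∀ v : Fin s → Fin (n + 1) → ℂ, eval (fun ij => v ij.1 ij.2) g ≠ 0 → P v := by
  classical
  obtain ⟨g, hg, hgP⟩ := hP
  obtain ⟨a, ha⟩ := MvPolynomial.support_nonempty.2 hg
  refine ⟨weightedHomogeneousComponent (multiWeight n s) (Finsupp.weight (multiWeight n s) a) g, _,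
    fun h => ?_, weightedHomogeneousComponent_isWeightedHomogeneous _ _, fun v hv => ?_⟩
  · have := congrArg (coeff a) h
    rw [coeff_weightedHomogeneousComponent, if_pos rfl, coeff_zero] at this
    exact mem_support_iff.1 ha this
  · rw [← coeff_aeval_scale] at hv
    -- Since one coefficient of g(t·v) is nonzero, some t with all entries nonzero has g(t·v) ≠ 0;
    -- the factor ∏ X_i keeps t off the coordinate hyperplanes.
    have h1 : (aeval (fun ij => C (v ij.1 ij.2) * X ij.1 : _ → MvPolynomial (Fin s) ℂ) g) ≠ 0 := by
      intro h; rw [h, coeff_zero] at hv; exact hv rfl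
    obtain ⟨t, ht⟩ := exists_eval_ne_zero (mul_ne_zero h1
      (Finset.prod_ne_zero_iff.2 fun i (_ : i ∈ Finset.univ) => X_ne_zero (R := ℂ) i))
    rw [map_mul, map_prod] at ht
    have ht' : ∀ i, t i ≠ 0 := fun i => by
      have := Finset.prod_ne_zero_iff.1 (right_ne_zero_of_mul ht) i (Finset.mem_univ i)
      rwa [eval_X] at this
    refine hscale v t ht' (hgP _ ?_)
    rw [eval_scale]
    exact left_ne_zero_of_mul ht

theorem Generic.forGeneralPoints {n s : ℕ} {P : (Fin s → Fin (n + 1) → ℂ) → Prop}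
    (hP : Generic P)
    (hscale : ∀ (v : Fin s → Fin (n + 1) → ℂ) (t : Fin s → ℂ), (∀ i, t i ≠ 0) →
      P (fun i => t i • v i) → P v) :
    ForGeneralPoints n s fun p => P fun i => (p i).rep := by
  obtain ⟨g, e, hg, hhom, hgP⟩ := hP.exists_isWeightedHomogeneous hscale
  refine ⟨{p | ∃ g' ∈ ({g} : Set _), eval (fun ij : Fin s × Fin (n + 1) => (p ij.1).rep ij.2) g' ≠ 0},
    ⟨{g}, ?_, rfl⟩, ?_, ?_⟩
  · rintro _ rfl
    exact isMultihomogeneous_of_isWeightedHomogeneous hhom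
  -- The product of the zeroth coordinates ensures that all vectors found are nonzero and so define
  -- points.
  · obtain ⟨x, hx⟩ := exists_eval_ne_zero (mul_ne_zero hg
      (Finset.prod_ne_zero_iff.2 fun i (_ : i ∈ Finset.univ) =>
        X_ne_zero (R := ℂ) (σ := Fin s × Fin (n + 1)) (i, 0)))
    rw [map_mul, map_prod] at hx
    have hx0 : ∀ i : Fin s, (fun k => x (i, k)) ≠ 0 := fun i h => by
      have := Finset.prod_ne_zero_iff.1 (right_ne_zero_of_mul hx) i (Finset.mem_univ i)
      rw [eval_X] at this
      exact this (congrFun h 0)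
    refine ⟨fun i => Projectivization.mk ℂ (fun k => x (i, k)) (hx0 i), g, rfl, ?_⟩
    have hrep : ∀ i : Fin s, ∃ c : ℂ, c ≠ 0 ∧
        (Projectivization.mk ℂ (fun k => x (i, k)) (hx0 i)).rep = c • fun k => x (i, k) := by
      intro i
      obtain ⟨a, ha⟩ := Projectivization.exists_smul_eq_mk_rep ℂ (fun k => x (i, k)) (hx0 i)
      exact ⟨a, a.ne_zero, ha.symm⟩
    choose t ht htr using hrep
    have := eval_scale_ne_zero (fun i k => x (i, k)) ht hhom (left_ne_zero_of_mul hx)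
    simpa only [htr] using this
  · rintro p ⟨_, rfl, h⟩
    exact hgP (fun i => (p i).rep) h

/-! ### Generic linear systems and general points -/

/-- A matrix over a domain has a nonzero kernel vector, or a left inverse up to a nonzero factor. -/
theorem exists_mulVec_eq_zero_or_exists_mul_eq_smul_one {R ρ κ : Type*} [CommRing R] [IsDomain R]
    [Fintype ρ] [Fintype κ] [DecidableEq ρ] [DecidableEq κ] (M : Matrix ρ κ R) :
    (∃ c : κ → R, c ≠ 0 ∧ M.mulVec c = 0) ∨
      ∃ h : R, h ≠ 0 ∧ ∃ L : Matrix κ ρ R, L * M = h • (1 : Matrix κ κ R) := by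
  set K := FractionRing R
  set φ := algebraMap R K
  have hφ : Function.Injective φ := IsFractionRing.injective R K
  -- Over the fraction field this is ordinary linear algebra; finitely many denominators are then
  -- cleared by one `b`.
  by_cases hker : (M.map φ).mulVecLin.ker = ⊥
  · right
    obtain ⟨g, hg⟩ := LinearMap.exists_leftInverse_of_injective _ hker
    obtain ⟨b, hb⟩ := IsLocalization.exist_integer_multiples_of_finite (nonZeroDivisors R)
      (fun x : κ × ρ => LinearMap.toMatrix' g x.1 x.2)
    choose L hL using hb
    refine ⟨b, nonZeroDivisors.coe_ne_zero b, Matrix.of fun k r => L (k, r), ?_⟩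
    have h1 : LinearMap.toMatrix' g * M.map φ = 1 := by
      rw [← LinearMap.toMatrix'_toLin' (M.map φ), ← LinearMap.toMatrix'_comp,
        Matrix.toLin'_apply', hg,
        LinearMap.toMatrix'_id]
    ext k l
    apply hφ
    have h2 := congrFun (congrFun h1 k) l
    rw [Matrix.mul_apply] at h2
    rw [Matrix.mul_apply, map_sum]
    have h3 : ∀ r, φ (Matrix.of (fun k r => L (k, r)) k r * M r l)
        = φ b * (LinearMap.toMatrix' g k r * M.map φ r l) := fun r => by
      have := hL (k, r)
      rw [map_mul, Matrix.of_apply, this, Algebra.smul_def, Matrix.map_apply, mul_assoc]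
    simp only [h3]
    rw [← Finset.mul_sum, h2]
    simp [Matrix.one_apply, apply_ite φ]
  · left
    obtain ⟨c, hc, hc0⟩ := (Submodule.ne_bot_iff _).1 hker
    obtain ⟨b, hb⟩ := IsLocalization.exist_integer_multiples_of_finite (nonZeroDivisors R) c
    choose c' hc' using hb
    have hb0 : φ b ≠ 0 := (map_ne_zero_iff φ hφ).2 (nonZeroDivisors.coe_ne_zero b)
    refine ⟨c', fun h => hc0 (funext fun k => ?_), funext fun r => hφ ?_⟩
    · have := hc' k
      rw [h, Pi.zero_apply, map_zero, Algebra.smul_def] at this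
      exact (mul_eq_zero.1 this.symm).resolve_left hb0
    · have h1 : (M.map φ).mulVec c r = 0 := congrFun (LinearMap.mem_ker.1 hc) r
      rw [RingHom.map_mulVec, Pi.zero_apply, map_zero]
      have h2 : φ ∘ c' = φ b • c := funext fun k => by
        have := hc' k
        rw [Algebra.smul_def] at this
        exact this
      rw [h2, Matrix.mulVec_smul, Pi.smul_apply, h1, smul_zero]

/-- The coefficients of the Taylor expansion of a form at the `j`-th of `s` generic vectors. -/
noncomputable def genericCoeff {n s : ℕ} (j : Fin s) (b : Fin (n + 1) →₀ ℕ) (f : CoordRing n) :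
    MvPolynomial (Fin s × Fin (n + 1)) ℂ :=
  coeff b (aeval (fun k => X k + C (X (j, k)) :
    Fin (n + 1) → MvPolynomial (Fin (n + 1)) (MvPolynomial (Fin s × Fin (n + 1)) ℂ)) f)

theorem aeval_genericCoeff {n s : ℕ} {S : Type*} [CommRing S] [Algebra ℂ S] (j : Fin s)
    (b : Fin (n + 1) →₀ ℕ) (f : CoordRing n) (v : Fin s × Fin (n + 1) → S) :
    aeval v (genericCoeff j b f) =
      coeff b (aeval (fun k => X k + C (v (j, k)) : Fin (n + 1) → MvPolynomial (Fin (n + 1)) S) f)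
      := by
  have h : map (aeval v : MvPolynomial (Fin s × Fin (n + 1)) ℂ →ₐ[ℂ] S).toRingHom
      (aeval (fun k => X k + C (X (j, k)) :
        Fin (n + 1) → MvPolynomial (Fin (n + 1)) (MvPolynomial (Fin s × Fin (n + 1)) ℂ)) f) =
      aeval (fun k => X k + C (v (j, k)) : Fin (n + 1) → MvPolynomial (Fin (n + 1)) S) f := by
    induction f using MvPolynomial.induction_on with
    | C a => simp [MvPolynomial.algebraMap_apply]
    | add p q hp hq => rw [map_add, map_add, map_add, hp, hq]
    | mul_X p j hp => rw [map_mul, map_mul, map_mul, hp]; simp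
  rw [← h, coeff_map]
  rfl

/-- The conditions do not involve the i-th point, so it can be moved off a given nonzero section. To
control all configurations by one polynomial, the conditions are put in a matrix `M` over the ring
of coordinates of the points. A kernel vector of `M` gives a universal section, whose value at the
i-th point is the required polynomial; otherwise generic configurations have no nonzero section and
nothing is claimed. -/
theorem generic_exists_eval_ne_zero {n s : ℕ} (A : Pic s) (i : Fin s) (hA : A.2 i ≤ 0) :
    Generic fun v : Fin s → Fin (n + 1) → ℂ =>
      h0 v A ≠ 0 → ∃ f ∈ sections v A, eval (v i) f ≠ 0 := by
  classical
  by_cases hd : A.1 < 0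
  · refine ⟨1, one_ne_zero, fun v _ h => ?_⟩
    obtain ⟨f, hf, hf0⟩ := h0_ne_zero_iff.1 h
    have := fst_eq_of_mem_sections hf hf0
    omega
  set R := MvPolynomial (Fin s × Fin (n + 1)) ℂ
  set W := homogeneousSubmodule (Fin (n + 1)) ℂ A.1.toNat
  have hfin : Module.Finite ℂ W := Module.Finite.iff_fg.2 (homogeneousSubmodule_fg _ _ _)
  set β := Module.finBasis ℂ W
  -- Exponents of degree below any prescribed multiplicity have all entries below N, so finitely
  -- many rows express all conditions; superfluous rows are zero.
  set N := ∑ j, (A.2 j).toNat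
  set toExp : (Fin (n + 1) → Fin N) → (Fin (n + 1) →₀ ℕ) :=
    fun b => Finsupp.equivFunOnFinite.symm fun k => (b k : ℕ)
  set M : Matrix (Fin s × (Fin (n + 1) → Fin N)) (Fin (Module.finrank ℂ W)) R := Matrix.of fun r κ =>
    if (toExp r.2).degree < (A.2 r.1).toNat then genericCoeff r.1 (toExp r.2) (β κ : CoordRing n)
      else 0 with hM
  have hcoeff : ∀ (v : Fin s → Fin (n + 1) → ℂ) (c : Fin (Module.finrank ℂ W) → ℂ)
      (r : Fin s × (Fin (n + 1) → Fin N)), (M.map (eval fun ij => v ij.1 ij.2)).mulVec c r =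
      if (toExp r.2).degree < (A.2 r.1).toNat then
        coeff (toExp r.2) (aeval (fun k => X k + C (v r.1 k)) ((∑ κ, c κ • β κ : W) : CoordRing n) :
          CoordRing n) else 0 := by
    intro v c r
    simp only [Matrix.mulVec, dotProduct, Matrix.map_apply, hM, Matrix.of_apply]
    split_ifs with h
    · rw [Submodule.coe_sum, map_sum, coeff_sum]
      refine Finset.sum_congr rfl fun κ _ => ?_
      rw [Submodule.coe_smul, map_smul, coeff_smul, smul_eq_mul, mul_comm, ← coe_aeval_eq_eval]
      congr 1
      exact aeval_genericCoeff _ _ _ _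
    · simp
  have hmem : ∀ (v : Fin s → Fin (n + 1) → ℂ) (c : Fin (Module.finrank ℂ W) → ℂ),
      ((∑ κ, c κ • β κ : W) : CoordRing n) ∈ sections v A ↔
        (M.map (eval fun ij => v ij.1 ij.2)).mulVec c = 0 := by
    intro v c
    constructor
    · intro h
      ext r
      rw [hcoeff, Pi.zero_apply]
      split_ifs with hr
      · exact natCast_le_ordAt_iff.1 (h.2 r.1) _ hr
      · rfl
    · intro h
      refine mem_sections_of_isHomogeneous (e := A.1.toNat) (∑ κ, c κ • β κ : W).2 (by omega)
        fun j => natCast_le_ordAt_iff.2 fun b hb => ?_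
      have hbN : ∀ k, b k < N := fun k => lt_of_le_of_lt (Finsupp.le_degree k b)
        (lt_of_lt_of_le hb (Finset.single_le_sum (f := fun j => (A.2 j).toNat)
          (fun _ _ => Nat.zero_le _) (Finset.mem_univ j)))
      have hexp : toExp (fun k => ⟨b k, hbN k⟩) = b := by ext k; simp [toExp]
      have := congrFun h (j, fun k => ⟨b k, hbN k⟩)
      rw [hcoeff] at this
      simpa only [hexp, hb, if_true, Pi.zero_apply] using this
  rcases exists_mulVec_eq_zero_or_exists_mul_eq_smul_one M with ⟨c, hc, hMc⟩ | ⟨h, hh, L, hL⟩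
  · obtain ⟨κ₀, hκ₀⟩ := Function.ne_iff.1 hc
    obtain ⟨v₀, hv₀⟩ := exists_eval_ne_zero hκ₀
    -- A kernel vector may depend on the i-th point, and its section might then vanish there
    -- identically. Freezing that point at `v₀` removes the dependence and fixes `M`, whose rows for
    -- i vanish.
    set θ : R →ₐ[ℂ] R := aeval fun ij => if ij.1 = i then C (v₀ ij) else X ij with hθ
    have hθM : ∀ r κ, θ (M r κ) = M r κ := by
      intro r κ
      simp only [hM, Matrix.of_apply]
      split_ifs with hr
      · have hri : r.1 ≠ i := by
          intro h
          rw [h] at hr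
          omega
        rw [hθ, aeval_genericCoeff, genericCoeff]
        simp [hri]
      · exact map_zero _
    have hMθc : M.mulVec (fun κ => θ (c κ)) = 0 := by
      ext1 r
      have := congrArg θ (congrFun hMc r)
      rw [Pi.zero_apply, map_zero, Matrix.mulVec, dotProduct, map_sum] at this
      simpa only [map_mul, hθM, Matrix.mulVec, dotProduct, Pi.zero_apply] using this
    set f₀ : W := ∑ κ, eval v₀ (c κ) • β κ with hf₀
    have hf₀0 : (f₀ : CoordRing n) ≠ 0 := by
      intro h
      have h1 : f₀ = 0 := Subtype.ext h
      exact hv₀ (Fintype.linearIndependent_iff.1 β.linearIndependent _ h1 κ₀)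
    obtain ⟨x, hx⟩ := exists_eval_ne_zero hf₀0
    have heval : ∀ v : Fin s × Fin (n + 1) → ℂ,
        eval v (∑ κ, θ (c κ) * aeval (fun k => X (i, k)) (β κ : CoordRing n)) =
          eval (fun k => v (i, k)) ((∑ κ, eval v (θ (c κ)) • β κ : W) : CoordRing n) := by
      intro v
      rw [map_sum, Submodule.coe_sum, map_sum]
      refine Finset.sum_congr rfl fun κ _ => ?_
      rw [map_mul, Submodule.coe_smul, smul_eval]
      congr 1
      rw [← coe_aeval_eq_eval, ← coe_aeval_eq_eval]
      change (aeval v) _ = (aeval _) _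
      rw [← AlgHom.comp_apply, comp_aeval]
      simp
    refine ⟨∑ κ, θ (c κ) * aeval (fun k => X (i, k)) (β κ : CoordRing n), fun h0 => ?_,
      fun v hv _ => ⟨((∑ κ, eval (fun ij => v ij.1 ij.2) (θ (c κ)) • β κ : W) : CoordRing n),
        (hmem v _).2 ?_, ?_⟩⟩
    -- Put the i-th point at x and the others at `v₀`: the polynomial takes the value f₀(x) ≠ 0.
    · have h1 := heval fun ij => if ij.1 = i then x ij.2 else v₀ ij
      rw [h0, map_zero] at h1
      have h2 : ∀ κ, eval (fun ij => if ij.1 = i then x ij.2 else v₀ ij) (θ (c κ)) =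
          eval v₀ (c κ) := by
        intro κ
        rw [← coe_aeval_eq_eval, ← coe_aeval_eq_eval]
        change (aeval _) _ = (aeval _) _
        rw [hθ, ← AlgHom.comp_apply, comp_aeval]
        congr 2
        ext1 ij
        by_cases hij : ij.1 = i <;> simp [hij]
      simp only [h2, if_true] at h1
      exact hx h1.symm
    · ext1 r
      have := congrArg (eval fun ij => v ij.1 ij.2) (congrFun hMθc r)
      rw [RingHom.map_mulVec, Pi.zero_apply, map_zero] at this
      exact this
    · rw [heval] at hv
      exact hv
  -- The coefficient vector c of a section satisfies M(v)c = 0, and L M = h then gives h(v)c = 0.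
  · refine ⟨h, hh, fun v hv hne => ?_⟩
    exfalso
    obtain ⟨f, hf, hf0⟩ := h0_ne_zero_iff.1 hne
    have hfW : f ∈ W := isHomogeneous_of_mem_sections hf
    set c := fun κ => β.repr ⟨f, hfW⟩ κ with hc
    have hsum : ∑ κ, c κ • β κ = ⟨f, hfW⟩ := β.sum_repr _
    have h1 := (hmem v c).1 (by rw [hsum]; exact hf)
    have h2 : (L * M).map (eval fun ij => v ij.1 ij.2) =
        eval (fun ij => v ij.1 ij.2) h • (1 : Matrix (Fin (Module.finrank ℂ W)) (Fin (Module.finrank ℂ W)) ℂ) := by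
      rw [hL]
      ext k l
      simp [Matrix.one_apply, apply_ite (eval _)]
    have h3 : (eval (fun ij => v ij.1 ij.2) h • (1 : Matrix (Fin (Module.finrank ℂ W)) (Fin (Module.finrank ℂ W)) ℂ)).mulVec c = 0 := by
      rw [← h2, Matrix.map_mul, ← Matrix.mulVec_mulVec, h1, Matrix.mulVec_zero]
    rw [Matrix.smul_mulVec, Matrix.one_mulVec, smul_eq_zero_iff_right hv] at h3
    apply hf0
    have h4 : (⟨f, hfW⟩ : W) = 0 := by
      rw [← hsum, h3]; simp
    exact congrArg Subtype.val h4

/-! ### The numerical form of the claim and its invariance -/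

/-- In terms of the dimensions `N` of the spaces of sections: the class `F` has a unique member,
which is prime, and this member has multiplicity exactly `k` in the base locus of the class `D`,
if `D` is effective. -/
structure IsPrimeWithMultiplicity {s : ℕ} (N : Pic s → ℕ) (D F : Pic s) (k : ℕ) : Prop where
  unique : N F = 1
  ne_zero : F ≠ 0
  indecomposable : ∀ B B', B + B' = F → N B ≠ 0 → N B' ≠ 0 → B = 0 ∨ B' = 0
  le_mult : N D ≠ 0 → N (D - k • F) = N D
  mult_le : N D ≠ 0 → N (D - (k + 1) • F) < N D

/-- Only dimensions and the group structure of Pic enter, so no map between the blow-ups themselves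
is needed. -/
theorem IsPrimeWithMultiplicity.map {s : ℕ} {N N' : Pic s → ℕ} {D F : Pic s} {k : ℕ}
    (h : IsPrimeWithMultiplicity N D F k) (w : Pic s ≃+ Pic s) (hw : ∀ A, N' (w A) = N A) :
    IsPrimeWithMultiplicity N' (w D) (w F) k where
  unique := by rw [hw, h.unique]
  ne_zero := by simpa using h.ne_zero
  indecomposable := by
    intro B B' hBB' hB hB'
    obtain ⟨B, rfl⟩ := w.surjective B
    obtain ⟨B', rfl⟩ := w.surjective B'
    rw [← map_add, w.apply_eq_iff_eq] at hBB'
    rw [hw] at hB hB'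
    simpa using h.indecomposable B B' hBB' hB hB'
  le_mult := by
    rw [← map_nsmul, ← map_sub, hw, hw]
    exact h.le_mult
  mult_le := by
    rw [← map_nsmul, ← map_sub, hw, hw]
    exact h.mult_le

theorem sections_of_fst_eq_zero {n s : ℕ} {v : Fin s → Fin (n + 1) → ℂ} {A : Pic s}
    (hA : A.1 = 0) {f : CoordRing n} (hf : f ∈ sections v A) : ∃ a, f = C a := by
  have h := isHomogeneous_of_mem_sections hf
  rw [hA, Int.toNat_zero] at h
  exact ⟨_, totalDegree_eq_zero_iff_eq_C.1 ((totalDegree_zero_iff_isHomogeneous _).2 h)⟩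

theorem snd_le_zero_of_fst_eq_zero {n s : ℕ} {v : Fin s → Fin (n + 1) → ℂ} {A : Pic s}
    (hA : A.1 = 0) (h : h0 v A ≠ 0) (i : Fin s) : A.2 i ≤ 0 := by
  obtain ⟨f, hf, hf0⟩ := h0_ne_zero_iff.1 h
  obtain ⟨a, rfl⟩ := sections_of_fst_eq_zero hA hf
  have h1 := hf.2 i
  rw [ordAt_C _ (by rintro rfl; exact hf0 C_0)] at h1
  have : (A.2 i).toNat ≤ 0 := by exact_mod_cast h1
  omega

theorem h0_excClass {n s : ℕ} (v : Fin s → Fin (n + 1) → ℂ) (i : Fin s) : h0 v (excClass i) = 1 := by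
  have : sections v (excClass i) = Submodule.span ℂ {(1 : CoordRing n)} := by
    ext f
    rw [Submodule.mem_span_singleton]
    constructor
    · intro hf
      obtain ⟨a, rfl⟩ := sections_of_fst_eq_zero rfl hf
      exact ⟨a, by rw [smul_eq_C_mul, mul_one]⟩
    · rintro ⟨a, rfl⟩
      refine Submodule.smul_mem _ _ (mem_sections_of_isHomogeneous (isHomogeneous_one _ _) rfl
        fun j => ?_)
      have : ((excClass i).2 j).toNat = 0 := by
        by_cases h : j = i <;> simp [excClass, h]
      rw [this]
      exact bot_le
  rw [h0, this, finrank_span_singleton one_ne_zero]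

theorem eval_eq_zero_of_one_le_ordAt {n : ℕ} {v : Fin (n + 1) → ℂ} {f : CoordRing n}
    (h : 1 ≤ ordAt v f) : eval v f = 0 := by
  have h1 := natCast_le_ordAt_iff (k := 1) |>.1 (by exact_mod_cast h) 0 (by simp)
  rw [← constantCoeff_eq] at h1
  have h2 : (constantCoeff : CoordRing n →+* ℂ).comp
      (aeval (fun j => X j + C (v j)) : CoordRing n →ₐ[ℂ] CoordRing n).toRingHom = eval v := by
    ext <;> simp
  rw [← h2]
  exact h1

/-- Effective classes of degree 0 are nonnegative sums of the E_j, so E_i is indecomposable.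
Subtracting l E_i raises m_i by l: for l = k it reaches 0 and still imposes nothing, for l = k + 1
it requires vanishing at the i-th point, which some section of D generically violates. -/
theorem generic_excClass {n s : ℕ} (D : Pic s) (i : Fin s) (k : ℕ) (hk : (k : ℤ) = -D.2 i) :
    Generic fun v : Fin s → Fin (n + 1) → ℂ =>
      IsPrimeWithMultiplicity (h0 v) D (excClass i) k := by
  obtain ⟨g, hg, hgP⟩ := generic_exists_eval_ne_zero (n := n) D i (by omega)
  have hsub : ∀ l : ℕ, D - l • excClass i = (D.1, fun j => D.2 j + if j = i then (l : ℤ) else 0) := by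
    intro l
    refine Prod.ext (by simp [excClass]) (funext fun j => ?_)
    by_cases h : j = i <;> simp [excClass, h]
  refine ⟨g, hg, fun v hv => ⟨h0_excClass v i, ?_, ?_, ?_, ?_⟩⟩
  · intro h
    have := congrFun (congrArg Prod.snd h) i
    simp [excClass] at this
  · intro B B' h hB hB'
    have h1 : B.1 + B'.1 = 0 := congrArg Prod.fst h
    have hB1 : 0 ≤ B.1 := by
      obtain ⟨f, hf, hf0⟩ := h0_ne_zero_iff.1 hB
      have := fst_eq_of_mem_sections hf hf0
      omega
    have hB1' : 0 ≤ B'.1 := by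
      obtain ⟨f, hf, hf0⟩ := h0_ne_zero_iff.1 hB'
      have := fst_eq_of_mem_sections hf hf0
      omega
    have hB2 := snd_le_zero_of_fst_eq_zero (by omega) hB
    have hB2' := snd_le_zero_of_fst_eq_zero (by omega) hB'
    have h2 : ∀ j, B.2 j + B'.2 j = -(Pi.single i 1 : Fin s → ℤ) j :=
      fun j => congrFun (congrArg Prod.snd h) j
    have hne : ∀ j, j ≠ i → B.2 j = 0 ∧ B'.2 j = 0 := by
      intro j hj
      have := h2 j
      have := hB2 j
      have := hB2' j
      simp [hj] at *
      omega
    have hi := h2 i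
    rw [Pi.single_eq_same] at hi
    have := hB2 i
    have := hB2' i
    rcases (by omega : B.2 i = 0 ∨ B'.2 i = 0) with h0 | h0
    · left
      refine Prod.ext (by simp; omega) (funext fun j => ?_)
      by_cases hj : j = i
      · subst hj; exact h0
      · exact (hne j hj).1
    · right
      refine Prod.ext (by simp; omega) (funext fun j => ?_)
      by_cases hj : j = i
      · subst hj; exact h0
      · exact (hne j hj).2
  · intro _
    have : sections v (D - k • excClass i) = sections v D := by
      ext f
      rw [hsub]
      refine and_congr Iff.rfl (forall_congr' fun j => ?_)
      have : (D.2 j + if j = i then (k : ℤ) else 0).toNat = (D.2 j).toNat := by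
        split_ifs with h
        · subst h; omega
        · rw [add_zero]
      rw [this]
    rw [h0, this, h0]
  · intro hD
    obtain ⟨f, hf, hfe⟩ := hgP v hv hD
    refine Submodule.finrank_lt_finrank_of_lt (lt_of_le_of_ne (fun f' hf' => ?_) fun heq => hfe ?_)
    · rw [hsub] at hf'
      refine ⟨hf'.1, fun j => le_trans ?_ (hf'.2 j)⟩
      have : (D.2 j).toNat ≤ (D.2 j + if j = i then ((k + 1 : ℕ) : ℤ) else 0).toNat := by
        split_ifs <;> omega
      exact_mod_cast this
    · rw [← heq, hsub] at hf
      have h1 := hf.2 i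
      apply eval_eq_zero_of_one_le_ordAt
      refine le_trans ?_ h1
      have : 1 ≤ (D.2 i + if i = i then ((k + 1 : ℕ) : ℤ) else 0).toNat := by
        rw [if_pos rfl]; omega
      exact_mod_cast this

theorem generic_permute {n s : ℕ} {D F : Pic s} {k : ℕ} (σ : Equiv.Perm (Fin s))
    (h : Generic fun v : Fin s → Fin (n + 1) → ℂ => IsPrimeWithMultiplicity (h0 v) D F k) :
    Generic fun v : Fin s → Fin (n + 1) → ℂ =>
      IsPrimeWithMultiplicity (h0 v) (permute σ D) (permute σ F) k := by
  obtain ⟨g, hg, hgP⟩ := h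
  refine ⟨rename (fun ij => (σ.symm ij.1, ij.2)) g, ?_, fun v hv => ?_⟩
  · rw [Ne, rename_eq_zero_iff_of_injective]
    · exact hg
    · rintro ⟨i, j⟩ ⟨i', j'⟩ h
      simpa using h
  · rw [eval_rename] at hv
    exact (hgP (v ∘ σ.symm) hv).map (permute σ) fun A => h0_permute v σ A

/-! ### Cremona transformations based at general points -/

/-- The standard Cremona involution in homogeneous coordinates. -/
def standardCremona {n : ℕ} {R : Type*} [CommRing R] (y : Fin (n + 1) → R) : Fin (n + 1) → R :=
  fun k => ∏ l ∈ Finset.univ.erase k, y l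

/-- The matrix whose columns are the vectors indexed by `ι`. -/
def baseMatrix {n s : ℕ} {R : Type*} (ι : Fin (n + 1) ↪ Fin s) (v : Fin s → Fin (n + 1) → R) :
    Matrix (Fin (n + 1)) (Fin (n + 1)) R :=
  Matrix.of fun k l => v (ι l) k

/-- The image of `s` vectors under the Cremona transformation based at those indexed by `ι`, which
themselves are kept. -/
def cremonaVec {n s : ℕ} {R : Type*} [CommRing R] (ι : Fin (n + 1) ↪ Fin s)
    (v : Fin s → Fin (n + 1) → R) : Fin s → Fin (n + 1) → R := fun i =>
  if ∃ k, ι k = i then v i else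
    (baseMatrix ι v).mulVec (standardCremona ((baseMatrix ι v).adjugate.mulVec (v i)))

theorem map_adjugate_mulVec {n s : ℕ} {R S : Type*} [CommRing R] [CommRing S] (φ : R →+* S)
    (ι : Fin (n + 1) ↪ Fin s) (v : Fin s → Fin (n + 1) → R) (i : Fin s) (k : Fin (n + 1)) :
    φ ((baseMatrix ι v).adjugate.mulVec (v i) k) =
      (baseMatrix ι fun i k => φ (v i k)).adjugate.mulVec (fun k => φ (v i k)) k := by
  rw [RingHom.map_mulVec]
  have := RingHom.map_adjugate φ (baseMatrix ι v)
  rw [RingHom.mapMatrix_apply, RingHom.mapMatrix_apply] at this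
  rw [this]
  rfl

/-- With adjugates for inverses and products for reciprocals, only ring operations occur. Applied to
evaluations, this says that the transformation is a polynomial map on configurations. -/
theorem map_cremonaVec {n s : ℕ} {R S : Type*} [CommRing R] [CommRing S] (φ : R →+* S)
    (ι : Fin (n + 1) ↪ Fin s) (v : Fin s → Fin (n + 1) → R) (i : Fin s) (k : Fin (n + 1)) :
    φ (cremonaVec ι v i k) = cremonaVec ι (fun i k => φ (v i k)) i k := by
  unfold cremonaVec
  split_ifs with h
  · rfl
  · rw [RingHom.map_mulVec]
    congr 1
    ext l
    simp only [Function.comp_apply, standardCremona, map_prod, map_adjugate_mulVec]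

theorem cremonaVec_of_mem {n s : ℕ} {R : Type*} [CommRing R] (ι : Fin (n + 1) ↪ Fin s)
    (v : Fin s → Fin (n + 1) → R) (k : Fin (n + 1)) : cremonaVec ι v (ι k) = v (ι k) :=
  if_pos ⟨k, rfl⟩

theorem cremonaVec_of_notMem {n s : ℕ} {R : Type*} [CommRing R] (ι : Fin (n + 1) ↪ Fin s)
    (v : Fin s → Fin (n + 1) → R) {i : Fin s} (hi : i ∉ Set.range ι) :
    cremonaVec ι v i =
      (baseMatrix ι v).mulVec (standardCremona ((baseMatrix ι v).adjugate.mulVec (v i))) :=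
  if_neg hi

theorem baseMatrix_cremonaVec {n s : ℕ} {R : Type*} [CommRing R] (ι : Fin (n + 1) ↪ Fin s)
    (v : Fin s → Fin (n + 1) → R) : baseMatrix ι (cremonaVec ι v) = baseMatrix ι v := by
  ext k l
  simp only [baseMatrix, Matrix.of_apply, cremonaVec_of_mem]

theorem standardCremona_eq_smul_inv {n : ℕ} {y : Fin (n + 1) → ℂ} (hy : ∀ k, y k ≠ 0) :
    standardCremona y = (∏ l, y l) • fun k => (y k)⁻¹ := by
  ext k
  rw [standardCremona, Pi.smul_apply, smul_eq_mul, ← Finset.mul_prod_erase _ _ (Finset.mem_univ k),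
    mul_comm (y k), mul_assoc, mul_inv_cancel₀ (hy k), mul_one]

/-- Vectors off the exceptional locus of the Cremona transformation based at those indexed
by `ι`. -/
def InGeneralPosition {n s : ℕ} (ι : Fin (n + 1) ↪ Fin s) (v : Fin s → Fin (n + 1) → ℂ) : Prop :=
  (baseMatrix ι v).det ≠ 0 ∧
    ∀ i ∉ Set.range ι, ∀ k, (baseMatrix ι v).adjugate.mulVec (v i) k ≠ 0

/-- The inverse of the base matrix moves the base points to the coordinate points, where the
transformation is coordinatewise inversion up to scalars. -/
theorem h0_cremonaVec {n s : ℕ} (ι : Fin (n + 1) ↪ Fin s) {v : Fin s → Fin (n + 1) → ℂ}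
    (hv : InGeneralPosition ι v) (A : Pic s) :
    h0 v (cremonaFun n (Finset.univ.map ι) A) = h0 (cremonaVec ι v) A := by
  classical
  set V := baseMatrix ι v with hV
  have hu : IsUnit V.det := isUnit_iff_ne_zero.2 hv.1
  have hVV : V⁻¹ * V = 1 := Matrix.nonsing_inv_mul V hu
  have hcol : ∀ k, V⁻¹.mulVec (v (ι k)) = Pi.single k 1 := by
    intro k
    have : v (ι k) = V.mulVec (Pi.single k 1) := by
      ext l; simp [hV, baseMatrix]
    rw [this, Matrix.mulVec_mulVec, hVV, Matrix.one_mulVec]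
  set y : Fin s → Fin (n + 1) → ℂ := fun i => V.adjugate.mulVec (v i) with hy
  -- Chosen so that the rescaled transformed vector is det V times 1/y_i, the exact coordinatewise
  -- inverse of V⁻¹v_i = y_i / det V.
  set t : Fin s → ℂ := fun i => if i ∈ Set.range ι then 1 else V.det / ∏ l, y i l with ht
  have ht0 : ∀ i, t i ≠ 0 := by
    intro i
    simp only [ht]
    split_ifs with h
    · exact one_ne_zero
    · exact div_ne_zero hv.1 (Finset.prod_ne_zero_iff.2 fun l _ => hv.2 i h l)
  have hw : ∀ i, V⁻¹.mulVec (v i) = V.det⁻¹ • y i := by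
    intro i
    rw [Matrix.inv_def, Ring.inverse_eq_inv', Matrix.smul_mulVec]
  rw [← h0_mulVec v hVV, ← h0_mulVec (cremonaVec ι v) hVV,
    ← h0_smul (fun i => V⁻¹.mulVec (cremonaVec ι v i)) ht0]
  refine h0_cremonaFun ι (fun k => ?_) hcol (fun i hi l => ?_) (fun i hi l => ?_) A
  · rw [cremonaVec_of_mem, hcol]
    simp [ht]
  all_goals
    have hval : t i • V⁻¹.mulVec (cremonaVec ι v i) = V.det • fun k => (y i k)⁻¹ := by
      rw [cremonaVec_of_notMem ι v hi, Matrix.mulVec_mulVec, hVV, Matrix.one_mulVec,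
        standardCremona_eq_smul_inv (hv.2 i hi), smul_smul]
      simp only [ht, if_neg hi]
      rw [div_mul_cancel₀]
      exact Finset.prod_ne_zero_iff.2 fun l _ => hv.2 i hi l
    rw [hval]
  · exact mul_ne_zero hv.1 (inv_ne_zero (hv.2 i hi l))
  · rw [hw]
    simp [mul_comm]

/-- The Cremona transformation is an involution, up to rescaling. -/
theorem exists_cremonaVec_cremonaVec {n s : ℕ} {ι : Fin (n + 1) ↪ Fin s}
    {v : Fin s → Fin (n + 1) → ℂ} (hv : InGeneralPosition ι v) :
    ∃ t : Fin s → ℂ, (∀ i, t i ≠ 0) ∧ cremonaVec ι (cremonaVec ι v) = fun i => t i • v i := by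
  have key : ∀ i, ∃ c : ℂ, c ≠ 0 ∧ cremonaVec ι (cremonaVec ι v) i = c • v i := by
    intro i
    by_cases hi : i ∈ Set.range ι
    · obtain ⟨k, rfl⟩ := hi
      exact ⟨1, one_ne_zero, by rw [cremonaVec_of_mem, cremonaVec_of_mem, one_smul]⟩
    · set V := baseMatrix ι v
      set y := V.adjugate.mulVec (v i) with hy
      have hy0 : ∀ k, y k ≠ 0 := hv.2 i hi
      have hp : ∏ l, y l ≠ 0 := Finset.prod_ne_zero_iff.2 fun l _ => hy0 l
      -- The base matrix is unchanged, and adj(V) V = det V cancels the intermediate change of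
      -- coordinates.
      have h1 : (cremonaVec ι (cremonaVec ι v)) i =
          V.mulVec (standardCremona (V.det • standardCremona y)) := by
        rw [cremonaVec_of_notMem _ _ hi, baseMatrix_cremonaVec, cremonaVec_of_notMem _ _ hi,
          Matrix.mulVec_mulVec, Matrix.adjugate_mul, Matrix.smul_mulVec, Matrix.one_mulVec]
      have hz : ∀ k, (V.det • standardCremona y) k ≠ 0 := fun k =>
        mul_ne_zero hv.1 (Finset.prod_ne_zero_iff.2 fun l _ => hy0 l)
      set z := V.det • standardCremona y with hzdef
      have h2 : (fun k => (z k)⁻¹) = (V.det * ∏ l, y l)⁻¹ • y := by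
        ext k
        rw [hzdef, standardCremona_eq_smul_inv hy0]
        simp only [Pi.smul_apply, smul_eq_mul, mul_inv, inv_inv, mul_assoc]
      have h3 : V.mulVec y = V.det • v i := by
        rw [hy, Matrix.mulVec_mulVec, Matrix.mul_adjugate, Matrix.smul_mulVec, Matrix.one_mulVec]
      refine ⟨(∏ l, z l) * (V.det * ∏ l, y l)⁻¹ * V.det, mul_ne_zero (mul_ne_zero
        (Finset.prod_ne_zero_iff.2 fun l _ => hz l) (inv_ne_zero (mul_ne_zero hv.1 hp))) hv.1, ?_⟩
      rw [h1, standardCremona_eq_smul_inv hz, h2, smul_smul, Matrix.mulVec_smul, h3, smul_smul]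
  choose t ht ht' using key
  exact ⟨t, ht, funext ht'⟩

/-- The polynomial whose nonvanishing means general position. -/
noncomputable def positionPoly {n s : ℕ} (ι : Fin (n + 1) ↪ Fin s) :
    MvPolynomial (Fin s × Fin (n + 1)) ℂ :=
  (baseMatrix ι fun i k => X (i, k)).det *
    ∏ i, ∏ k, if ∃ l, ι l = i then 1 else
      (baseMatrix ι fun i k => X (i, k)).adjugate.mulVec (fun k => X (i, k)) k

theorem eval_positionPoly_ne_zero_iff {n s : ℕ} (ι : Fin (n + 1) ↪ Fin s)
    (v : Fin s → Fin (n + 1) → ℂ) :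
    eval (fun ij => v ij.1 ij.2) (positionPoly ι) ≠ 0 ↔ InGeneralPosition ι v := by
  rw [positionPoly, map_mul, map_prod, mul_ne_zero_iff, Finset.prod_ne_zero_iff]
  refine and_congr ?_ ⟨fun h i hi k => ?_, fun h i _ => ?_⟩
  · rw [RingHom.map_det]
    have : (eval fun ij : Fin s × Fin (n + 1) => v ij.1 ij.2).mapMatrix
        (baseMatrix ι fun i k => X (i, k)) = baseMatrix ι v := by
      ext k l; simp [baseMatrix]
    rw [this]
  · have h1 := h i (Finset.mem_univ i)
    rw [map_prod, Finset.prod_ne_zero_iff] at h1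
    have h2 := h1 k (Finset.mem_univ k)
    rw [if_neg (show ¬∃ l, ι l = i from hi), map_adjugate_mulVec (eval fun ij : Fin s × Fin (n + 1) => v ij.1 ij.2) ι
      (fun i k => X (i, k))] at h2
    simpa only [eval_X] using h2
  · rw [map_prod, Finset.prod_ne_zero_iff]
    intro k _
    split_ifs with hi
    · simp
    · rw [map_adjugate_mulVec (eval fun ij : Fin s × Fin (n + 1) => v ij.1 ij.2) ι
        (fun i k => X (i, k))]
      simpa only [eval_X] using h i hi k

theorem positionPoly_ne_zero {n s : ℕ} (ι : Fin (n + 1) ↪ Fin s) : positionPoly ι ≠ 0 := by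
  classical
  -- Base points at the coordinate points and every other point at (1, …, 1).
  set v : Fin s → Fin (n + 1) → ℂ := fun i k => if i ∈ Set.range ι then (if i = ι k then 1 else 0)
    else 1 with hv
  have hV : baseMatrix ι v = 1 := by
    ext k l
    simp [baseMatrix, hv, Matrix.one_apply, ι.injective.eq_iff, eq_comm]
  have : InGeneralPosition ι v := by
    refine ⟨by rw [hV]; simp, fun i hi k => ?_⟩
    rw [hV, Matrix.adjugate_one, Matrix.one_mulVec]
    simp only [hv, if_neg hi]
    exact one_ne_zero
  intro h
  have := (eval_positionPoly_ne_zero_iff ι v).2 this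
  rw [h, map_zero] at this
  exact this rfl

theorem isPrimeWithMultiplicity_of_smul {n s : ℕ} {D F : Pic s} {k : ℕ}
    (v : Fin s → Fin (n + 1) → ℂ) (t : Fin s → ℂ) (ht : ∀ i, t i ≠ 0)
    (h : IsPrimeWithMultiplicity (h0 fun i => t i • v i) D F k) :
    IsPrimeWithMultiplicity (h0 v) D F k := by
  rwa [h0_smul v ht] at h

/-- Pull the polynomial back along `cremonaVec`. It is first made multihomogeneous, so that its
nonvanishing survives the rescaling in the involution property. -/
theorem generic_cremona {n s : ℕ} {D F : Pic s} {k : ℕ} (J : Finset (Fin s)) (hJ : J.card = n + 1)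
    (h : Generic fun v : Fin s → Fin (n + 1) → ℂ => IsPrimeWithMultiplicity (h0 v) D F k) :
    Generic fun v : Fin s → Fin (n + 1) → ℂ =>
      IsPrimeWithMultiplicity (h0 v) (cremona n J hJ D) (cremona n J hJ F) k := by
  set ι : Fin (n + 1) ↪ Fin s := (J.orderEmbOfFin hJ).toEmbedding
  have hιJ : Finset.univ.map ι = J := Finset.map_orderEmbOfFin_univ J hJ
  obtain ⟨g, e, hg, hhom, hgP⟩ := h.exists_isWeightedHomogeneous isPrimeWithMultiplicity_of_smul
  set g' : MvPolynomial (Fin s × Fin (n + 1)) ℂ :=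
    aeval (fun ij => cremonaVec ι (fun i k => X (i, k)) ij.1 ij.2) g with hg'
  have heval : ∀ v : Fin s → Fin (n + 1) → ℂ, eval (fun ij => v ij.1 ij.2) g' =
      eval (fun ij => cremonaVec ι v ij.1 ij.2) g := by
    intro v
    rw [hg', ← coe_aeval_eq_eval, ← coe_aeval_eq_eval]
    change (aeval _) _ = (aeval _) _
    rw [← AlgHom.comp_apply, comp_aeval]
    congr 2
    ext1 ij
    have := map_cremonaVec (eval fun ij : Fin s × Fin (n + 1) => v ij.1 ij.2) ι
      (fun i k => X (i, k)) ij.1 ij.2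
    simp only [eval_X] at this
    exact this
  refine ⟨g' * positionPoly ι, mul_ne_zero (fun h0 => ?_) (positionPoly_ne_zero ι), fun v hv => ?_⟩
  -- At the transform of x the pullback takes the value of `g` at a rescaling of x, so it is not the
  -- zero polynomial.
  · obtain ⟨x, hx⟩ := exists_eval_ne_zero (mul_ne_zero hg (positionPoly_ne_zero ι))
    rw [map_mul] at hx
    have hpos : InGeneralPosition ι fun i k => x (i, k) :=
      (eval_positionPoly_ne_zero_iff ι fun i k => x (i, k)).1 (right_ne_zero_of_mul hx)
    obtain ⟨t, ht, htv⟩ := exists_cremonaVec_cremonaVec hpos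
    have h1 := eval_scale_ne_zero (fun i k => x (i, k)) ht hhom (left_ne_zero_of_mul hx)
    have h2 := heval (cremonaVec ι fun i k => x (i, k))
    rw [h0, map_zero, htv] at h2
    exact h1 h2.symm
  · rw [map_mul] at hv
    have hpos := (eval_positionPoly_ne_zero_iff ι v).1 (right_ne_zero_of_mul hv)
    have h1 := left_ne_zero_of_mul hv
    rw [heval] at h1
    refine (hgP _ h1).map (cremona n J hJ) fun A => ?_
    rw [← h0_cremonaVec ι hpos, hιJ]
    rfl

/-! ### From dimensions back to divisors -/

/-- Lowest degree and total degree are both additive on products. They agree for the product, hence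
for each factor. -/
theorem isHomogeneous_of_mul {σ : Type*} {f g : MvPolynomial σ ℂ} {d : ℕ}
    (h : (f * g).IsHomogeneous d) (hf : f ≠ 0) (hg : g ≠ 0) :
    ∃ e e', f.IsHomogeneous e ∧ g.IsHomogeneous e' ∧ e + e' = d := by
  have key : ∀ {q : MvPolynomial σ ℂ}, q ≠ 0 → ∃ a : ℕ,
      MvPowerSeries.order (q : MvPowerSeries σ ℂ) = a ∧ a ≤ q.totalDegree ∧
        (a = q.totalDegree → q.IsHomogeneous a) := by
    intro q hq
    have hne : (q : MvPowerSeries σ ℂ) ≠ 0 := by rwa [Ne, coe_eq_zero_iff]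
    obtain ⟨a, ha⟩ : ∃ a : ℕ, MvPowerSeries.order (q : MvPowerSeries σ ℂ) = a :=
      ⟨_, (ENat.natCast_toNat (mt MvPowerSeries.order_eq_top_iff.1 hne)).symm⟩
    have hlow : ∀ b ∈ q.support, a ≤ b.degree := by
      intro b hb
      have := MvPowerSeries.order_le (f := (q : MvPowerSeries σ ℂ)) (d := b)
        (by rw [coeff_coe]; exact mem_support_iff.1 hb)
      rw [ha] at this
      exact_mod_cast this
    have hup : ∀ b ∈ q.support, b.degree ≤ q.totalDegree := by
      intro b hb
      rw [Finsupp.degree_apply]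
      exact le_totalDegree hb
    refine ⟨a, ha, ?_, fun h => ?_⟩
    · obtain ⟨b, hb⟩ := MvPolynomial.support_nonempty.2 hq
      exact (hlow b hb).trans (hup b hb)
    · rw [← mem_homogeneousSubmodule, homogeneousSubmodule_eq_finsupp_supported]
      intro b hb
      have := hlow b hb
      have := hup b hb
      simp only [Set.mem_ofPred_eq]
      omega
  obtain ⟨a, ha, hle, hhom⟩ := key hf
  obtain ⟨a', ha', hle', hhom'⟩ := key hg
  have hfg : f * g ≠ 0 := mul_ne_zero hf hg
  have h1 : f.totalDegree + g.totalDegree = d := by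
    rw [← totalDegree_mul_of_isDomain hf hg, h.totalDegree hfg]
  have h2 : d ≤ a + a' := by
    have : (d : ℕ∞) ≤ MvPowerSeries.order ((f * g : MvPolynomial σ ℂ) : MvPowerSeries σ ℂ) := by
      refine MvPowerSeries.nat_le_order fun b hb => ?_
      rw [coeff_coe]
      exact h.coeff_eq_zero hb.ne
    rw [coe_mul, MvPowerSeries.order_mul, ha, ha'] at this
    exact_mod_cast this
  exact ⟨a, a', hhom (by omega), hhom' (by omega), by omega⟩

theorem isUnit_iff_exists_C {n : ℕ} {f : CoordRing n} : IsUnit f ↔ ∃ a : ℂ, a ≠ 0 ∧ f = C a := by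
  rw [MvPolynomial.isUnit_iff_eq_C_of_isReduced]
  simp only [isUnit_iff_ne_zero]

/-- For `f ≠ 0` the exponents of G dividing f are bounded, so the `sSup` is a true maximum and not a
default value. -/
theorem le_pullbackOrd_strictTransform_iff {n s : ℕ} (p : Fin s → Pt n) {f G : CoordRing n}
    (hf : f ≠ 0) (hG : Irreducible G) {Z : IrredHypersurface n} (hZ : Z.1 = Ideal.span {G}) {k : ℕ} :
    k ≤ pullbackOrd p f (.strictTransform Z) ↔ G ^ k ∣ f := by
  have hfin : FiniteMultiplicity G f := FiniteMultiplicity.of_not_isUnit hG.not_isUnit hf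
  have : {k : ℕ | f ∈ Z.1 ^ k} = Set.Iic (multiplicity G f) := by
    ext k
    rw [Set.mem_ofPred_eq, hZ, Ideal.span_singleton_pow, Ideal.mem_span_singleton,
      hfin.pow_dvd_iff_le_multiplicity, Set.mem_Iic]
  rw [pullbackOrd, this, csSup_Iic, hfin.pow_dvd_iff_le_multiplicity]

theorem exists_generator {n : ℕ} (Z : IrredHypersurface n) :
    ∃ G : CoordRing n, Irreducible G ∧ Z.1 = Ideal.span {G} := by
  obtain ⟨G, e, hG, -, hZ⟩ := Z.2
  exact ⟨G, hG, hZ⟩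

theorem pullbackOrd_mul {n s : ℕ} (p : Fin s → Pt n) {f g : CoordRing n} (hf : f ≠ 0) (hg : g ≠ 0)
    (P : PrimeDivisor p) : pullbackOrd p (f * g) P = pullbackOrd p f P + pullbackOrd p g P := by
  cases P with
  | strictTransform Z =>
    obtain ⟨G, hG, hZ⟩ := exists_generator Z
    have hmul : ∀ {q : CoordRing n}, q ≠ 0 →
        pullbackOrd p q (.strictTransform Z) = multiplicity G q := by
      intro q hq
      have hfin : FiniteMultiplicity G q := FiniteMultiplicity.of_not_isUnit hG.not_isUnit hq
      exact eq_of_forall_le_iff fun k => by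
        rw [le_pullbackOrd_strictTransform_iff p hq hG hZ, hfin.pow_dvd_iff_le_multiplicity]
    rw [hmul hf, hmul hg, hmul (mul_ne_zero hf hg)]
    exact multiplicity_mul hG.prime
      (FiniteMultiplicity.of_not_isUnit hG.not_isUnit (mul_ne_zero hf hg))
  | exceptional i =>
    have : (multAt (p i) (f * g) : ℕ∞) = (multAt (p i) f + multAt (p i) g : ℕ) := by
      rw [Nat.cast_add, multAt_eq_ordAt _ hf, multAt_eq_ordAt _ hg,
        multAt_eq_ordAt _ (mul_ne_zero hf hg), ordAt_mul]
    exact_mod_cast this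

theorem pullbackOrd_C {n s : ℕ} (p : Fin s → Pt n) {a : ℂ} (ha : a ≠ 0)
    (P : PrimeDivisor p) : pullbackOrd p (C a) P = 0 := by
  have hC : (C a : CoordRing n) ≠ 0 := C_ne_zero.2 ha
  cases P with
  | strictTransform Z =>
    obtain ⟨G, hG, hZ⟩ := exists_generator Z
    by_contra h
    have := (le_pullbackOrd_strictTransform_iff p hC hG hZ).1 (Nat.one_le_iff_ne_zero.2 h)
    rw [pow_one] at this
    exact hG.not_isUnit (isUnit_of_dvd_unit this (isUnit_iff_exists_C.2 ⟨a, ha, rfl⟩))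
  | exceptional i =>
    have : (multAt (p i) (C a) : ℕ∞) = (0 : ℕ) := by
      rw [multAt_eq_ordAt _ hC, ordAt_C _ ha, Nat.cast_zero]
    exact_mod_cast this

theorem pullbackOrd_pow {n s : ℕ} (p : Fin s → Pt n) {f : CoordRing n} (hf : f ≠ 0) (k : ℕ)
    (P : PrimeDivisor p) : pullbackOrd p (f ^ k) P = k * pullbackOrd p f P := by
  induction k with
  | zero => rw [pow_zero, zero_mul, ← C_1, pullbackOrd_C p one_ne_zero]
  | succ k ih => rw [pow_succ, pullbackOrd_mul p (pow_ne_zero k hf) hf, ih, add_mul, one_mul]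

theorem excCoeff_le_pullbackOrd {n s : ℕ} {p : Fin s → Pt n} {A : Pic s} {f : CoordRing n}
    (hf : f ∈ sections (fun i => (p i).rep) A) (hf0 : f ≠ 0) (P : PrimeDivisor p) :
    excCoeff A.2 P ≤ pullbackOrd p f P := by
  cases P with
  | strictTransform Z => exact Nat.cast_nonneg _
  | exceptional i =>
    have h := hf.2 i
    rw [← multAt_eq_ordAt _ hf0] at h
    have : (A.2 i).toNat ≤ multAt (p i) f := by exact_mod_cast h
    simp only [excCoeff, pullbackOrd]
    omega

/-- Only ideals generated by the finitely many irreducible factors of `f` can occur, besides the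
exceptional divisors. -/
theorem finite_support_pullbackOrd {n s : ℕ} (p : Fin s → Pt n) {f : CoordRing n} (hf : f ≠ 0)
    (m : Fin s → ℤ) : {P : PrimeDivisor p | (pullbackOrd p f P : ℤ) - excCoeff m P ≠ 0}.Finite := by
  classical
  have h1 : {Z : IrredHypersurface n | pullbackOrd p f (.strictTransform Z) ≠ 0}.Finite := by
    refine Set.Finite.of_finite_image
      (f := (Subtype.val : IrredHypersurface n → Ideal (CoordRing n)))
      (Set.Finite.subset ((UniqueFactorizationMonoid.factors f).toFinset.image
        fun q => Ideal.span {q}).finite_toSet ?_) Subtype.val_injective.injOn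
    rintro _ ⟨Z, hZ, rfl⟩
    obtain ⟨G, hG, hZG⟩ := exists_generator Z
    have hdvd := (le_pullbackOrd_strictTransform_iff p hf hG hZG).1 (Nat.one_le_iff_ne_zero.2 hZ)
    rw [pow_one] at hdvd
    obtain ⟨q, hq, hqG⟩ := UniqueFactorizationMonoid.exists_mem_factors_of_dvd hf hG hdvd
    rw [Finset.coe_image]
    exact ⟨q, by simpa using hq, by rw [hZG, Ideal.span_singleton_eq_span_singleton.2 hqG]⟩
  refine ((h1.image PrimeDivisor.strictTransform).union
    (Set.finite_range PrimeDivisor.exceptional)).subset ?_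
  rintro (Z | i) h
  · left
    refine ⟨Z, fun h0 => h ?_, rfl⟩
    rw [h0]
    rfl
  · right
    exact ⟨i, rfl⟩

theorem mem_linearSystem_iff {n s : ℕ} {p : Fin s → Pt n} {A : Pic s} {Δ : Divisor p} :
    Δ ∈ linearSystem p A ↔ ∃ f ∈ sections (fun i => (p i).rep) A, f ≠ 0 ∧
      ∀ P, Δ P = (pullbackOrd p f P : ℤ) - excCoeff A.2 P := by
  constructor
  · rintro ⟨hΔ, f, e, hf0, hf, he, h⟩
    refine ⟨f, mem_sections_of_isHomogeneous hf he fun i => ?_, hf0, h⟩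
    have h1 := h (.exceptional i)
    have h2 : 0 ≤ Δ (.exceptional i) := hΔ _
    rw [← multAt_eq_ordAt _ hf0]
    simp only [excCoeff, pullbackOrd] at h1
    have : (A.2 i).toNat ≤ multAt (p i) f := by omega
    exact_mod_cast this
  · rintro ⟨f, hf, hf0, h⟩
    refine ⟨fun P => ?_, f, A.1.toNat, hf0, isHomogeneous_of_mem_sections hf,
      fst_eq_of_mem_sections hf hf0, h⟩
    have := excCoeff_le_pullbackOrd hf hf0 P
    rw [h P, Finsupp.coe_zero, Pi.zero_apply]
    omega

theorem exists_divisor {n s : ℕ} {p : Fin s → Pt n} {A : Pic s} {f : CoordRing n}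
    (hf : f ∈ sections (fun i => (p i).rep) A) (hf0 : f ≠ 0) :
    ∃ Δ ∈ linearSystem p A, ∀ P, Δ P = (pullbackOrd p f P : ℤ) - excCoeff A.2 P :=
  ⟨Finsupp.ofSupportFinite _ (finite_support_pullbackOrd p hf0 A.2),
    mem_linearSystem_iff.2 ⟨f, hf, hf0, fun _ => rfl⟩, fun _ => rfl⟩

theorem mul_mem_sections {n s : ℕ} {v : Fin s → Fin (n + 1) → ℂ} {A B : Pic s} {f g : CoordRing n}
    (hf : f ∈ sections v A) (hg : g ∈ sections v B) : f * g ∈ sections v (A + B) := by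
  by_cases hf0 : f = 0
  · simp [hf0]
  by_cases hg0 : g = 0
  · simp [hg0]
  refine mem_sections_of_isHomogeneous
    ((isHomogeneous_of_mem_sections hf).mul (isHomogeneous_of_mem_sections hg)) ?_ fun i => ?_
  · have := fst_eq_of_mem_sections hf hf0
    have := fst_eq_of_mem_sections hg hg0
    rw [Prod.fst_add]
    omega
  · rw [ordAt_mul]
    refine le_trans ?_ (add_le_add (hf.2 i) (hg.2 i))
    have : ((A + B).2 i).toNat ≤ (A.2 i).toNat + (B.2 i).toNat := by
      rw [Prod.snd_add, Pi.add_apply]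
      omega
    exact_mod_cast this

theorem pow_mem_sections {n s : ℕ} {v : Fin s → Fin (n + 1) → ℂ} {A : Pic s} {f : CoordRing n}
    (hf : f ∈ sections v A) (k : ℕ) : f ^ k ∈ sections v (k • A) := by
  induction k with
  | zero =>
    rw [pow_zero, zero_smul]
    exact mem_sections_of_isHomogeneous (isHomogeneous_one _ _) rfl fun i => by simp
  | succ k ih =>
    rw [pow_succ, succ_nsmul]
    exact mul_mem_sections ih hf

/-- A quotient of sections is a section, if the denominator has the prescribed multiplicities. -/
theorem mem_sections_of_mul_mem {n s : ℕ} {p : Fin s → Pt n} {A B : Pic s} {g h : CoordRing n}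
    (hgh : g * h ∈ sections (fun i => (p i).rep) A) (hg0 : g ≠ 0) (hh0 : h ≠ 0)
    (hg : g.IsHomogeneous B.1.toNat) (hB : 0 ≤ B.1) (hgB : ∀ i, (multAt (p i) g : ℤ) = B.2 i) :
    h ∈ sections (fun i => (p i).rep) (A - B) := by
  have hne : g * h ≠ 0 := mul_ne_zero hg0 hh0
  obtain ⟨e, e', he, he', hsum⟩ := isHomogeneous_of_mul (isHomogeneous_of_mem_sections hgh) hg0 hh0
  have h1 := he.inj_right hg hg0
  have h2 := fst_eq_of_mem_sections hgh hne
  refine mem_sections_of_isHomogeneous he' ?_ fun i => ?_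
  · rw [Prod.fst_sub]
    omega
  · have h3 := hgh.2 i
    rw [ordAt_mul, ← multAt_eq_ordAt _ hg0, ← multAt_eq_ordAt _ hh0] at h3
    have h4 : (A.2 i).toNat ≤ multAt (p i) g + multAt (p i) h := by exact_mod_cast h3
    have h5 := hgB i
    rw [← multAt_eq_ordAt _ hh0]
    have : ((A - B).2 i).toNat ≤ multAt (p i) h := by
      rw [Prod.snd_sub, Pi.sub_apply]
      omega
    exact_mod_cast this

theorem multAt_eq_pullbackOrd {n s : ℕ} (p : Fin s → Pt n) (f : CoordRing n) (i : Fin s) :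
    multAt (p i) f = pullbackOrd p f (.exceptional i) := rfl

/-- The unique section of an indecomposable class vanishes exactly along one prime divisor `P`, and
sections that vanish along `P` are divisible by it. -/
theorem IsPrimeWithMultiplicity.exists_primeDivisor {n s : ℕ} {p : Fin s → Pt n} {D F : Pic s}
    {k : ℕ} (hN : IsPrimeWithMultiplicity (h0 fun i => (p i).rep) D F k) {g : CoordRing n}
    (hg : g ∈ sections (fun i => (p i).rep) F) (hg0 : g ≠ 0) :
    ∃ P : PrimeDivisor p,
      (∀ P', (Finsupp.single P (1 : ℤ)) P' = (pullbackOrd p g P' : ℤ) - excCoeff F.2 P') ∧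
      ∀ (A : Pic s) (f : CoordRing n) (l : ℕ), f ∈ sections (fun i => (p i).rep) A → f ≠ 0 →
        (l : ℤ) ≤ (pullbackOrd p f P : ℤ) - excCoeff A.2 P →
        ∃ h ∈ sections (fun i => (p i).rep) (A - l • F), f = g ^ l * h := by
  classical
  by_cases hu : IsUnit g
  -- A constant section: F is a nonzero nonnegative sum of exceptional classes, and splitting off
  -- one of them shows that F equals it.
  · obtain ⟨a, ha, rfl⟩ := isUnit_iff_exists_C.1 hu
    have hF1 : F.1 = 0 := by
      have h1 := fst_eq_of_mem_sections hg hg0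
      have h2 := (isHomogeneous_of_mem_sections hg).inj_right (isHomogeneous_C _ a) hg0
      omega
    have hF2 := snd_le_zero_of_fst_eq_zero hF1 (h0_ne_zero_iff.2 ⟨_, hg, hg0⟩)
    obtain ⟨i, hi⟩ : ∃ i, F.2 i ≠ 0 := by
      by_contra! h
      exact hN.ne_zero (Prod.ext hF1 (funext h))
    have hFi : F = excClass i := by
      have hB' : h0 (fun i => (p i).rep) (F - excClass i) ≠ 0 := by
        refine h0_ne_zero_iff.2 ⟨1, mem_sections_of_isHomogeneous (isHomogeneous_one _ _)
          (by simp [excClass, hF1]) fun j => ?_, one_ne_zero⟩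
        have : ((F - excClass i).2 j).toNat = 0 := by
          have := hF2 j
          have := hF2 i
          by_cases hj : j = i
          · subst hj; simp [excClass]; omega
          · simp [excClass, hj]; omega
        rw [this]
        exact bot_le
      rcases hN.indecomposable (excClass i) (F - excClass i) (add_sub_cancel _ _)
        (by rw [h0_excClass]; exact one_ne_zero) hB' with h | h
      · have := congrFun (congrArg Prod.snd h) i
        simp [excClass] at this
      · exact sub_eq_zero.1 h
    refine ⟨.exceptional i, fun P' => ?_, fun A f l hf hf0 hl => ?_⟩
    · rw [pullbackOrd_C p ha, hFi]
      cases P' with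
      | strictTransform Z => simp [excCoeff]
      | exceptional j =>
        simp [excCoeff, excClass, Finsupp.single_apply, Pi.single_apply, eq_comm]
    · have hal : a ^ l ≠ 0 := pow_ne_zero l ha
      refine ⟨C (a ^ l)⁻¹ * f, ?_, ?_⟩
      · rw [← smul_eq_C_mul]
        refine Submodule.smul_mem _ _ (mem_sections_of_isHomogeneous
          (isHomogeneous_of_mem_sections hf) ?_ fun j => ?_)
        · rw [fst_eq_of_mem_sections hf hf0]
          simp [hF1]
        · rw [← multAt_eq_ordAt _ hf0]
          have h1 := excCoeff_le_pullbackOrd hf hf0 (.exceptional j)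
          have : ((A - l • F).2 j).toNat ≤ multAt (p j) f := by
            simp only [excCoeff, pullbackOrd] at h1 hl
            by_cases hj : j = i
            · subst hj; simp [hFi, excClass]; omega
            · simp [hFi, excClass, hj]; omega
          exact_mod_cast this
      · rw [← mul_assoc, ← C_pow, ← C_mul, mul_inv_cancel₀ hal, C_1, one_mul]
  -- For an irreducible factor G let B be the class of its strict transform, with the exact
  -- multiplicities of G. Then q is a section of F - B, so indecomposability gives F = B and q is
  -- constant.
  · obtain ⟨G, hG, q, rfl⟩ := WfDvdMonoid.exists_irreducible_factor hu hg0
    have hG0 : G ≠ 0 := hG.ne_zero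
    have hq0 : q ≠ 0 := right_ne_zero_of_mul hg0
    obtain ⟨e, e', hGe, hqe, -⟩ := isHomogeneous_of_mul (isHomogeneous_of_mem_sections hg) hG0 hq0
    set B : Pic s := (e, fun i => multAt (p i) G) with hB
    have hGB : G ∈ sections (fun i => (p i).rep) B := by
      refine mem_sections_of_isHomogeneous hGe rfl fun i => ?_
      rw [← multAt_eq_ordAt _ hG0]
      simp [hB]
    have hqB : q ∈ sections (fun i => (p i).rep) (F - B) :=
      mem_sections_of_mul_mem hg hG0 hq0 (by simpa [hB] using hGe) (by simp [hB])
        fun i => by simp [hB]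
    have hB0 : B ≠ 0 := by
      intro h
      obtain ⟨a, rfl⟩ := sections_of_fst_eq_zero (by rw [h]; rfl) hGB
      exact hG.not_isUnit (isUnit_iff_exists_C.2 ⟨a, by rintro rfl; exact hG0 C_0, rfl⟩)
    have hFB : F = B := sub_eq_zero.1 ((hN.indecomposable B (F - B) (add_sub_cancel _ _)
      (h0_ne_zero_iff.2 ⟨_, hGB, hG0⟩) (h0_ne_zero_iff.2 ⟨_, hqB, hq0⟩)).resolve_left hB0)
    obtain ⟨a, rfl⟩ := sections_of_fst_eq_zero (by rw [hFB, sub_self]; rfl) hqB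
    have ha : a ≠ 0 := by rintro rfl; exact hq0 C_0
    have hord : ∀ P', pullbackOrd p (G * C a) P' = pullbackOrd p G P' := fun P' => by
      rw [pullbackOrd_mul p hG0 hq0, pullbackOrd_C p ha, add_zero]
    set Z : IrredHypersurface n := ⟨Ideal.span {G}, G, e, hG, hGe, rfl⟩ with hZ
    refine ⟨.strictTransform Z, fun P' => ?_, fun A f l hf hf0 hl => ?_⟩
    · rw [hord]
      cases P' with
      | strictTransform Z' =>
        obtain ⟨G', hG', hZ'⟩ := exists_generator Z'
        have h1 : pullbackOrd p G (.strictTransform Z') = if Z = Z' then 1 else 0 := by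
          refine eq_of_forall_le_iff fun k => ?_
          rw [le_pullbackOrd_strictTransform_iff p hG0 hG' hZ']
          rcases Nat.eq_zero_or_pos k with rfl | hk
          · simp
          split_ifs with h
          · have hass : Associated G G' := by
              rw [← Ideal.span_singleton_eq_span_singleton, ← hZ', ← h]
            constructor
            · intro hd
              by_contra! hk1
              have h2 : G' ^ 2 ∣ G' := ((pow_dvd_pow G' hk1).trans hd).trans hass.dvd
              rw [pow_two] at h2
              exact hG'.not_isUnit (isUnit_of_dvd_one
                ((mul_dvd_mul_iff_left hG'.ne_zero).1 (by simpa using h2)))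
            · intro hk1
              obtain rfl : k = 1 := by omega
              rw [pow_one]
              exact hass.symm.dvd
          · refine ⟨fun hd => absurd ?_ h, fun h => absurd h (by omega)⟩
            have h2 : G' ∣ G := (dvd_pow_self G' hk.ne').trans hd
            apply Subtype.ext
            rw [hZ']
            exact Ideal.span_singleton_eq_span_singleton.2 (hG'.associated_of_dvd hG h2).symm
        rw [h1]
        simp [excCoeff, Finsupp.single_apply]
      | exceptional i =>
        simp [excCoeff, hFB, hB, pullbackOrd]
    · have h1 : G ^ l ∣ f := by
        rw [← le_pullbackOrd_strictTransform_iff p hf0 hG (Z := Z) rfl]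
        simpa [excCoeff] using hl
      obtain ⟨h, rfl⟩ := h1
      have hal : a ^ l ≠ 0 := pow_ne_zero l ha
      have hh0 : h ≠ 0 := right_ne_zero_of_mul hf0
      have hlB : (l • B).1 = ((l * e : ℕ) : ℤ) := by
        rw [Prod.smul_fst]
        simp [hB]
      refine ⟨C (a ^ l)⁻¹ * h, ?_, ?_⟩
      · rw [← smul_eq_C_mul]
        refine Submodule.smul_mem _ _ (mem_sections_of_mul_mem hf (pow_ne_zero l hG0) hh0 ?_ ?_ ?_)
        · have := hGe.pow l
          rw [hFB]
          rwa [hlB, Int.toNat_natCast, mul_comm]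
        · rw [hFB, hlB]
          exact Nat.cast_nonneg _
        · intro i
          rw [multAt_eq_pullbackOrd, pullbackOrd_pow p hG0, hFB]
          simp [hB, pullbackOrd]
      · have hC : (C a : CoordRing n) ^ l * C (a ^ l)⁻¹ = 1 := by
          rw [← C_pow, ← C_mul, mul_inv_cancel₀ hal, C_1]
        linear_combination (-(G ^ l * h)) * hC

theorem finrank_map_mulLeft {n : ℕ} {g : CoordRing n} (hg : g ≠ 0) (S : Submodule ℂ (CoordRing n)) :
    Module.finrank ℂ (S.map (LinearMap.mulLeft ℂ g)) = Module.finrank ℂ S :=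
  (Submodule.equivMapOfInjective (LinearMap.mulLeft ℂ g) (mul_right_injective₀ hg) S).finrank_eq.symm

theorem IsPrimeWithMultiplicity.exists_hasBaseMultiplicity {n s : ℕ} {p : Fin s → Pt n}
    {D F : Pic s} {k : ℕ} (hN : IsPrimeWithMultiplicity (h0 fun i => (p i).rep) D F k) :
    ∃ P : PrimeDivisor p, linearSystem p F = {Finsupp.single P 1} ∧
      ((linearSystem p D).Nonempty → HasBaseMultiplicity (linearSystem p D) P k) := by
  obtain ⟨⟨g, hg⟩, hg0', hspan⟩ := finrank_eq_one_iff'.1 hN.unique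
  have hg0 : g ≠ 0 := fun h => hg0' (Subtype.ext h)
  obtain ⟨P, hP, hdvd⟩ := hN.exists_primeDivisor hg hg0
  have hPP : (pullbackOrd p g P : ℤ) - excCoeff F.2 P = 1 := by
    rw [← hP P, Finsupp.single_eq_same]
  have hmul : ∀ l : ℕ, ∀ h ∈ sections (fun i => (p i).rep) (D - l • F),
      g ^ l * h ∈ sections (fun i => (p i).rep) D := by
    intro l h hh
    have := mul_mem_sections (pow_mem_sections hg l) hh
    rwa [add_sub_cancel] at this
  refine ⟨P, Set.eq_singleton_iff_unique_mem.2 ⟨mem_linearSystem_iff.2 ⟨g, hg, hg0, hP⟩,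
    fun Δ hΔ => ?_⟩, fun hne => ?_⟩
  · obtain ⟨f, hf, hf0, hΔf⟩ := mem_linearSystem_iff.1 hΔ
    obtain ⟨c, hc⟩ := hspan ⟨f, hf⟩
    have hc' : c • g = f := congrArg Subtype.val hc
    have hc0 : c ≠ 0 := by
      rintro rfl
      exact hf0 (by rw [← hc', zero_smul])
    ext P'
    rw [hΔf, hP, ← hc', smul_eq_C_mul, pullbackOrd_mul p (C_ne_zero.2 hc0) hg0,
      pullbackOrd_C p hc0, zero_add]
  · obtain ⟨Δ₀, hΔ₀⟩ := hne
    obtain ⟨f₀, hf₀, hf₀0, -⟩ := mem_linearSystem_iff.1 hΔ₀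
    have hD : h0 (fun i => (p i).rep) D ≠ 0 := h0_ne_zero_iff.2 ⟨f₀, hf₀, hf₀0⟩
    have hlower : ∀ f ∈ sections (fun i => (p i).rep) D, f ≠ 0 →
        (k : ℤ) ≤ (pullbackOrd p f P : ℤ) - excCoeff D.2 P := by
      intro f hf hf0
      -- Multiplication by g ^ k is injective, so equal dimensions make it fill all sections of D.
      have heq : (sections (fun i => (p i).rep) (D - k • F)).map (LinearMap.mulLeft ℂ (g ^ k)) =
          sections (fun i => (p i).rep) D := by
        refine Submodule.eq_of_le_of_finrank_eq ?_ ?_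
        · rintro _ ⟨h, hh, rfl⟩
          exact hmul k h hh
        · rw [finrank_map_mulLeft (pow_ne_zero k hg0)]
          exact hN.le_mult hD
      rw [← heq] at hf
      obtain ⟨h, hh, rfl⟩ := hf
      rw [LinearMap.mulLeft_apply] at hf0 ⊢
      have hh0 : h ≠ 0 := right_ne_zero_of_mul hf0
      have h1 := excCoeff_le_pullbackOrd hh hh0 P
      have h2 : excCoeff (D - k • F).2 P = excCoeff D.2 P - k * excCoeff F.2 P := by
        cases P <;> simp [excCoeff]
      rw [pullbackOrd_mul p (pow_ne_zero k hg0) hh0, pullbackOrd_pow p hg0]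
      push_cast
      have h3 : (k : ℤ) * ((pullbackOrd p g P : ℤ) - excCoeff F.2 P) = k := by rw [hPP, mul_one]
      linarith
    refine ⟨?_, ?_⟩
    · have hex : ∃ f ∈ sections (fun i => (p i).rep) D, f ≠ 0 ∧
          (pullbackOrd p f P : ℤ) - excCoeff D.2 P < k + 1 := by
        -- If every section had order at least k + 1 along P, all would be divisible by g ^ (k + 1),
        -- against the strict drop in dimension.
        by_contra! hall
        have hle : sections (fun i => (p i).rep) D ≤
            (sections (fun i => (p i).rep) (D - (k + 1) • F)).map
              (LinearMap.mulLeft ℂ (g ^ (k + 1))) := by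
          intro f hf
          by_cases hf0 : f = 0
          · rw [hf0]; exact Submodule.zero_mem _
          · obtain ⟨h, hh, rfl⟩ := hdvd D f (k + 1) hf hf0 (by exact_mod_cast hall f hf hf0)
            exact ⟨h, hh, rfl⟩
        have h1 := Submodule.finrank_mono hle
        rw [finrank_map_mulLeft (pow_ne_zero _ hg0)] at h1
        exact absurd (hN.mult_le hD) (not_lt.2 h1)
      obtain ⟨f, hf, hf0, hlt⟩ := hex
      obtain ⟨Δ, hΔ, hΔf⟩ := exists_divisor hf hf0
      refine ⟨Δ, hΔ, ?_⟩
      have := hlower f hf hf0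
      have := hΔf P
      change Δ P = k
      omega
    · rintro _ ⟨Δ, hΔ, rfl⟩
      obtain ⟨f, hf, hf0, hΔf⟩ := mem_linearSystem_iff.1 hΔ
      change (k : ℤ) ≤ Δ P
      rw [hΔf]
      exact hlower f hf hf0

/-! ### The Weyl group -/

theorem form_permute (n : ℕ) {s : ℕ} (σ : Equiv.Perm (Fin s)) (A B : Pic s) :
    form n (permute σ A) (permute σ B) = form n A B := by
  have : ∑ i, A.2 (σ i) * B.2 (σ i) = ∑ i, A.2 i * B.2 i :=
    Equiv.sum_comp σ fun i => A.2 i * B.2 i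
  simp only [form, permute, AddEquiv.coe_mk, Equiv.coe_fn_mk, this]

/-- Write a and b for the Cremona shifts of A and B. Because |J| = n + 1, the change in the sum of
the m_i products cancels the change in (n - 1) times the product of degrees. -/
theorem form_cremona (n : ℕ) {s : ℕ} (J : Finset (Fin s)) (hJ : J.card = n + 1) (A B : Pic s) :
    form n (cremona n J hJ A) (cremona n J hJ B) = form n A B := by
  change form n (cremonaFun n J A) (cremonaFun n J B) = form n A B
  set a := ∑ j ∈ J, A.2 j - ((n : ℤ) - 1) * A.1 with ha
  set b := ∑ j ∈ J, B.2 j - ((n : ℤ) - 1) * B.1 with hb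
  have h1 : ∀ i, (cremonaFun n J A).2 i * (cremonaFun n J B).2 i =
      A.2 i * B.2 i + if i ∈ J then a * b - a * B.2 i - b * A.2 i else 0 := by
    intro i
    simp only [cremonaFun]
    split_ifs <;> ring
  have h2 : ∑ i, (if i ∈ J then a * b - a * B.2 i - b * A.2 i else 0) =
      ((n : ℤ) + 1) * (a * b) - a * ∑ j ∈ J, B.2 j - b * ∑ j ∈ J, A.2 j := by
    rw [Finset.sum_ite_mem, Finset.univ_inter, Finset.sum_sub_distrib, Finset.sum_sub_distrib,
      ← Finset.mul_sum _ B.2, ← Finset.mul_sum _ A.2, Finset.sum_const, hJ, nsmul_eq_mul]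
    push_cast
    ring
  have h3 : (cremonaFun n J A).1 = A.1 - a := rfl
  have h4 : (cremonaFun n J B).1 = B.1 - b := rfl
  simp only [form, h1, Finset.sum_add_distrib, h2, h3, h4]
  rw [show ∑ j ∈ J, A.2 j = a + ((n : ℤ) - 1) * A.1 by rw [ha]; ring,
    show ∑ j ∈ J, B.2 j = b + ((n : ℤ) - 1) * B.1 by rw [hb]; ring]
  ring

theorem form_weylGroup {n s : ℕ} {w : Pic s ≃ₗ[ℤ] Pic s} (hw : w ∈ weylGroup n s) (A B : Pic s) :
    form n (w A) (w B) = form n A B := by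
  induction hw using Subgroup.closure_induction generalizing A B with
  | mem w hw =>
    rcases hw with ⟨σ, rfl⟩ | ⟨J, hJ, rfl⟩
    · exact form_permute n σ A B
    · exact form_cremona n J hJ A B
  | one => rfl
  | mul x y _ _ hx hy => rw [LinearEquiv.mul_apply, LinearEquiv.mul_apply, hx, hy]
  | inv x _ hx =>
    have := hx (x⁻¹ A) (x⁻¹ B)
    rwa [← LinearEquiv.mul_apply, ← LinearEquiv.mul_apply, mul_inv_cancel, eq_comm] at this

/-- Stating an equivalence lets the induction pass to inverses; for generators the converse follows
by applying the inverse permutation or the same Cremona transformation again. -/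
theorem generic_weylGroup {n s k : ℕ} {w : Pic s ≃ₗ[ℤ] Pic s} (hw : w ∈ weylGroup n s)
    (D F : Pic s) :
    (Generic fun v : Fin s → Fin (n + 1) → ℂ => IsPrimeWithMultiplicity (h0 v) D F k) ↔
      Generic fun v : Fin s → Fin (n + 1) → ℂ =>
        IsPrimeWithMultiplicity (h0 v) (w D) (w F) k := by
  induction hw using Subgroup.closure_induction generalizing D F with
  | mem w hw =>
    rcases hw with ⟨σ, rfl⟩ | ⟨J, hJ, rfl⟩
    · refine ⟨generic_permute σ, fun h => ?_⟩
      have hinv : ∀ A : Pic s, permute σ.symm (permute σ A) = A := (permute σ).left_inv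
      have := generic_permute σ.symm h
      change Generic fun v : Fin s → Fin (n + 1) → ℂ => IsPrimeWithMultiplicity (h0 v)
        (permute σ.symm (permute σ D)) (permute σ.symm (permute σ F)) k at this
      rwa [hinv, hinv] at this
    · refine ⟨generic_cremona J hJ, fun h => ?_⟩
      have hinv : ∀ A : Pic s, cremona n J hJ (cremona n J hJ A) = A := (cremona n J hJ).left_inv
      have := generic_cremona J hJ h
      change Generic fun v : Fin s → Fin (n + 1) → ℂ => IsPrimeWithMultiplicity (h0 v)
        (cremona n J hJ (cremona n J hJ D)) (cremona n J hJ (cremona n J hJ F)) k at this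
      rwa [hinv, hinv] at this
  | one => rfl
  | mul x y _ _ hx hy => rw [hy, hx]; rfl
  | inv x _ hx =>
    rw [hx (x⁻¹ D) (x⁻¹ F), ← LinearEquiv.mul_apply, ← LinearEquiv.mul_apply, mul_inv_cancel]
    rfl

end BlowUp

/-! ### Reduction to an exceptional divisor -/

theorem proposition2p3 (n s : ℕ) (hn : 2 ≤ n) (D F : BlowUp.Pic s)
    (hF : ∃ w ∈ BlowUp.weylGroup n s, ∃ i : Fin s, F = w (BlowUp.excClass i))
    (hDF : BlowUp.form n D F ≤ 0) :
    BlowUp.ForGeneralPoints n s fun p =>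
      ∃ P : BlowUp.PrimeDivisor p,
        BlowUp.linearSystem p F = {Finsupp.single P 1} ∧
        ((BlowUp.linearSystem p D).Nonempty →
          BlowUp.HasBaseMultiplicity (BlowUp.linearSystem p D) P (-BlowUp.form n D F)) := by
  obtain ⟨w, hw, i, rfl⟩ := hF
  obtain ⟨k, hk⟩ : ∃ k : ℕ, (k : ℤ) = -BlowUp.form n D (w (BlowUp.excClass i)) :=
    ⟨_, Int.toNat_of_nonneg (by omega)⟩
  have hwD : w (w⁻¹ D) = D := by rw [← LinearEquiv.mul_apply, mul_inv_cancel]; rfl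
  -- By invariance the pairing is that of w⁻¹D with E_i, which reads off its i-th multiplicity.
  have hform : BlowUp.form n D (w (BlowUp.excClass i)) = (w⁻¹ D).2 i := by
    conv_lhs => rw [← hwD]
    rw [BlowUp.form_weylGroup hw]
    simp [BlowUp.form, BlowUp.excClass, Pi.single_apply]
  have hgen := (BlowUp.generic_weylGroup hw (w⁻¹ D) (BlowUp.excClass i)).1
    (BlowUp.generic_excClass (n := n) (w⁻¹ D) i k (by rw [hk, hform]))
  rw [hwD] at hgen
  obtain ⟨U, hU, hne, h⟩ := hgen.forGeneralPoints BlowUp.isPrimeWithMultiplicity_of_smul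
  refine ⟨U, hU, hne, fun p hp => ?_⟩
  rw [← hk]
  exact (h p hp).exists_hasBaseMultiplicity
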